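/- Let $\mathbb D$ be the open unit disc in $\mathbb C$ and let $n\ge 1$. Let $\pi_n=(\pi_{n,1},\dots,\pi_{n,n}):\mathbb C^n\to\mathbb C^n$ be the symmetrization map, $$\pi_{n,k}(\lambda_1,\dots,\lambda_n)=\sum_{1\le j_1<\dots<j_k\le n}\lambda_{j_1}\cdots\lambda_{j_k},\qquad k=1,\dots,n,$$ and let $\mathbb G_n=\pi_n(\mathbb D^n)$ be the symmetrized polydisc. Let $f:\mathbb G_n\to\mathbb G_n$ be a holomorphic mapping. Then $f$ is proper (as a mapping $\mathbb G_n\to\mathbb G_n$) if and only if there exists a finite Blaschke product $$B(z)=c\prod_{j=1}^m\frac{z-a_j}{1-\overline{a_j}z},\qquad m\ge 1,\ |c|=1,\ a_1,\dots,a_m\in\mathbb D,$$ such that $$f\big(\pi_n(\lambda_1,\dots,\lambda_n)\big)=\pi_n\big(B(\lambda_1),\dots,B(\lambda_n)\big),\qquad \lambda_1,\dots,\lambda_n\in\mathbb D.$$ In particular, $f$ is a holomorphic automorphism of $\mathbb G_n$ if and only if there exists a holomorphic automorphism $h$ of $\mathbb D$ such that $$f\big(\pi_n(\lambda_1,\dots,\lambda_n)\big)=\pi_n\big(h(\lambda_1),\dots,h(\lambda_n)\big),\qquad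 \lambda_1,\dots,\lambda_n\in\mathbb D.$$ -/

import Mathlib

namespace SymPolydisc

/-- The open unit disc in `ℂ`. -/
def disc : Set ℂ := Metric.ball 0 1

/-- The polydisc `𝔻ⁿ` in `ℂⁿ`. -/
def polydisc (n : ℕ) : Set (Fin n → ℂ) := {z | ∀ j, z j ∈ disc}

/-- The symmetrization map `πₙ : ℂⁿ → ℂⁿ`; its coordinates are the elementary symmetric functions
of degrees `1, …, n` (the coordinate with index `k : Fin n` is the one of degree `k + 1`). -/
noncomputable def symMap (n : ℕ) (z : Fin n → ℂ) : Fin n → ℂ := fun k =>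
  ∑ s ∈ Finset.powersetCard ((k : ℕ) + 1) (Finset.univ : Finset (Fin n)), ∏ j ∈ s, z j

/-- The symmetrized polydisc `𝔾ₙ = πₙ(𝔻ⁿ)`. -/
def symPolydisc (n : ℕ) : Set (Fin n → ℂ) := symMap n '' polydisc n

/-- `B` is on the unit disc a (nonconstant) finite Blaschke product
`c ∏ⱼ (z - aⱼ) / (1 - conj aⱼ z)` with `|c| = 1`, all `|aⱼ| < 1` and at least one factor. -/
def IsFiniteBlaschke (B : ℂ → ℂ) : Prop :=
  ∃ (m : ℕ) (c : ℂ) (a : Fin m → ℂ), 1 ≤ m ∧ ‖c‖ = 1 ∧ (∀ j, a j ∈ disc) ∧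
    ∀ z ∈ disc, B z = c * ∏ j, (z - a j) / (1 - starRingEnd ℂ (a j) * z)

/-- `f` restricts to a holomorphic automorphism of `D`: a holomorphic self-map of `D` that has a
holomorphic two-sided inverse `D → D`. -/
def IsHolAut {E : Type*} [NormedAddCommGroup E] [NormedSpace ℂ E] (D : Set E) (f : E → E) : Prop :=
  Set.MapsTo f D D ∧ DifferentiableOn ℂ f D ∧
    ∃ g : E → E, Set.MapsTo g D D ∧ DifferentiableOn ℂ g D ∧
      (∀ x ∈ D, g (f x) = x) ∧ (∀ x ∈ D, f (g x) = x)

end SymPolydisc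

/-! A point `w` of the symmetrized polydisc is treated as the monic polynomial `symPoly w`, all of
whose roots lie in the disc. For proper `f` put F = f ∘ πₙ, a symmetric proper holomorphic map on
the polydisc. The aim is a holomorphic `b` such that b(μᵢ) is a root of the polynomial of F(μ),
whatever the other variables are.

When μᵢ tends to the unit circle, properness gives the limit polynomial a unimodular root, and
Harnack's inequality makes this root common to all choices of the other variables
(`IsProperHol.exists_common_root`). By the maximum principle, a holomorphic relation between
coefficient vectors that follows from having a common unimodular root then holds inside the disc too
(`IsProperHol.relation_eq_zero`).

This is used twice. With determinants, it shows that freezing a variable strictly lowers the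
dimension of the span of the coefficient vectors; the full span lies in ℂⁿ⁺¹, so freezing one
variable leaves exactly a hyperplane. With the Veronese relations between the cofactors, it shows
that the normal of that hyperplane is proportional to (1, b, …, bⁿ), so the hyperplane consists of
the polynomials vanishing at b (`IsProperHol.exists_local_root`).

By symmetry every b(μⱼ) is a root, so F(μ) = πₙ(b(μ₁), …, b(μₙ)), first where these are distinct and
then by density (`IsProperHol.exists_eq_symMap`). Restriction to the diagonal shows that `b` is
proper, hence a finite Blaschke product. The converse follows by lifting to roots. For
automorphisms, the same result is applied to the inverse; conversely, the inverse of `h` is Möbius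
and induces a rational inverse of `f`. -/

namespace SymPolydisc
-- Points of the symmetrized polydisc as monic polynomials.
open Polynomial

/-- The monic polynomial of degree `n` with coefficients `± w k`. -/
noncomputable def symPoly {n : ℕ} (w : Fin n → ℂ) : ℂ[X] :=
  X ^ n + ∑ k : Fin n, C ((-1) ^ ((k : ℕ) + 1) * w k) * X ^ (n - 1 - (k : ℕ))

/-- The coefficients of `symPoly w`. -/
noncomputable def coeffVec {n : ℕ} (w : Fin n → ℂ) : Fin (n + 1) → ℂ :=
  fun l => (symPoly w).coeff l

lemma symPoly_coeff {n : ℕ} (w : Fin n → ℂ) (l : ℕ) :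
    (symPoly w).coeff l = (if l = n then 1 else 0) +
      ∑ k : Fin n, if l = n - 1 - (k : ℕ) then (-1) ^ ((k : ℕ) + 1) * w k else 0 := by
  simp only [symPoly, coeff_add, coeff_X_pow, finsetSum_coeff, coeff_C_mul, mul_ite, mul_one,
    mul_zero]

lemma symPoly_coeff_sub {n : ℕ} (w : Fin n → ℂ) (k : Fin n) :
    (symPoly w).coeff (n - 1 - k) = (-1) ^ ((k : ℕ) + 1) * w k := by
  rw [symPoly_coeff, if_neg (by have := k.2; omega), zero_add, Finset.sum_eq_single k]
  · simp
  · intro j _ hj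
    rw [if_neg]
    intro h
    apply hj
    ext
    have := j.2
    have := k.2
    omega
  · simp

lemma symPoly_injective {n : ℕ} : Function.Injective (symPoly (n := n)) := by
  intro w w' h
  ext k
  have := symPoly_coeff_sub w k
  rw [h, symPoly_coeff_sub] at this
  exact (mul_left_cancel₀ (by simp) this).symm

/-- Vieta's formula in homogeneous form: A = X, B = 1 is the usual one, while other choices compute
the effect of a Möbius transformation on the roots. -/
lemma prod_sub_C_mul {n : ℕ} (z : Fin n → ℂ) (A B : ℂ[X]) :
    ∏ j, (A - C (z j) * B) = A ^ n + ∑ k : Fin n, C ((-1) ^ ((k : ℕ) + 1) * symMap n z k) *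
      (A ^ (n - 1 - (k : ℕ)) * B ^ ((k : ℕ) + 1)) := by
  have h1 : ∀ j, (A - C (z j) * B : ℂ[X]) = - (C (z j) * B) + A := fun j => by ring
  simp_rw [h1, Finset.prod_add, Finset.prod_const]
  have h2 : ∀ s ∈ (Finset.univ : Finset (Fin n)).powerset,
      (∏ j ∈ s, -(C (z j) * B)) * A ^ (Finset.card (Finset.univ \ s)) =
      C ((-1) ^ s.card * ∏ j ∈ s, z j) * (A ^ (n - s.card) * B ^ s.card) := by
    intro s _
    rw [Finset.prod_neg, Finset.card_sdiff_of_subset (Finset.subset_univ s), Finset.prod_mul_distrib]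
    simp
    ring
  rw [Finset.sum_congr rfl h2, Finset.sum_powerset]
  simp only [Finset.card_univ, Fintype.card_fin]
  rw [Finset.sum_range_succ', add_comm, Finset.powersetCard_zero]
  simp only [Finset.sum_singleton, Finset.card_empty, Finset.prod_empty]
  congr 1
  · simp
  · rw [Finset.sum_range]
    refine Finset.sum_congr rfl fun k _ => ?_
    rw [symMap, Finset.mul_sum, map_sum, Finset.sum_mul]
    refine Finset.sum_congr rfl fun s hs => ?_
    rw [(Finset.mem_powersetCard.1 hs).2]
    congr 3
    omega

lemma symPoly_symMap {n : ℕ} (z : Fin n → ℂ) :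
    symPoly (symMap n z) = ∏ j, (X - C (z j)) := by
  have := prod_sub_C_mul z X 1
  simp only [mul_one, one_pow] at this
  rw [this, symPoly]

lemma symPoly_natDegree_lt {n : ℕ} (w : Fin n → ℂ) : (symPoly w).natDegree < n + 1 := by
  rw [Nat.lt_succ_iff, natDegree_le_iff_coeff_eq_zero]
  intro l hl
  rw [symPoly_coeff, if_neg (by omega), zero_add]
  exact Finset.sum_eq_zero fun k _ => if_neg (by omega)

lemma symPoly_eval {n : ℕ} (w : Fin n → ℂ) (t : ℂ) :
    (symPoly w).eval t = ∑ l : Fin (n + 1), coeffVec w l * t ^ (l : ℕ) := by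
  rw [eval_eq_sum_range' (symPoly_natDegree_lt w), Finset.sum_range]
  rfl

lemma coeffVec_last {n : ℕ} (w : Fin n → ℂ) : coeffVec w (Fin.last n) = 1 := by
  rw [coeffVec, symPoly_coeff, Finset.sum_eq_zero]
  · simp
  · intro k _
    rw [if_neg]
    have := k.2
    simp
    omega

lemma differentiable_coeffVec (n : ℕ) : Differentiable ℂ (coeffVec (n := n)) := by
  rw [differentiable_pi]
  intro l
  simp only [coeffVec, symPoly_coeff]
  refine (differentiable_const _).add (Differentiable.fun_sum fun k _ => ?_)
  split_ifs <;> fun_prop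

lemma differentiable_symMap (n : ℕ) : Differentiable ℂ (symMap n) := by
  rw [differentiable_pi]
  intro k
  unfold symMap
  fun_prop

lemma eval_symPoly_symMap {n : ℕ} (z : Fin n → ℂ) (t : ℂ) :
    (symPoly (symMap n z)).eval t = ∏ j, (t - z j) := by
  simp [symPoly_symMap, eval_prod]

lemma exists_eq_of_symMap_eq {n : ℕ} {z z' : Fin n → ℂ} (h : symMap n z = symMap n z') (j : Fin n) :
    ∃ i, z j = z' i := by
  have h1 : (symPoly (symMap n z)).eval (z j) = 0 := by
    rw [eval_symPoly_symMap]
    exact Finset.prod_eq_zero (Finset.mem_univ j) (sub_self _)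
  rw [h, eval_symPoly_symMap, Finset.prod_eq_zero_iff] at h1
  obtain ⟨i, -, hi⟩ := h1
  exact ⟨i, sub_eq_zero.1 hi⟩

lemma mem_polydisc_of_symMap_mem {n : ℕ} {z : Fin n → ℂ} (h : symMap n z ∈ symPolydisc n) :
    z ∈ polydisc n := by
  obtain ⟨y, hy, hyz⟩ := h
  intro j
  obtain ⟨i, hi⟩ := exists_eq_of_symMap_eq hyz.symm j
  rw [hi]
  exact hy i

lemma symMap_comp_perm {n : ℕ} (z : Fin n → ℂ) (σ : Equiv.Perm (Fin n)) :
    symMap n (z ∘ σ) = symMap n z := by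
  apply symPoly_injective
  rw [symPoly_symMap, symPoly_symMap]
  exact Equiv.prod_comp σ (fun j => X - C (z j))

/-- Pairwise distinct roots of `symPoly w` determine `w`. -/
lemma eq_symMap_of_roots {n : ℕ} {w : Fin n → ℂ} (hw : ∃ z, symMap n z = w) {β : Fin n → ℂ}
    (hβ : Function.Injective β) (h : ∀ j, (symPoly w).eval (β j) = 0) : w = symMap n β := by
  obtain ⟨z, rfl⟩ := hw
  apply symPoly_injective
  -- Both polynomials are monic of degree n, so their difference has degree below n and n distinct
  -- nodes suffice.
  refine eq_of_degree_sub_lt_of_eval_index_eq (s := Finset.univ) (v := β) hβ.injOn ?_ ?_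
  · simp only [Finset.card_univ, Fintype.card_fin]
    have hd : ∀ y : Fin n → ℂ, (symPoly (symMap n y)).degree = n := fun y => by
      rw [symPoly_symMap, degree_prod]
      simp
    have hm : ∀ y : Fin n → ℂ, (symPoly (symMap n y)).Monic := fun y => by
      rw [symPoly_symMap]
      exact monic_prod_of_monic _ _ fun j _ => monic_X_sub_C _
    have := degree_sub_lt_left ((hd z).trans (hd β).symm) (hm z).ne_zero
      ((hm z).leadingCoeff.trans (hm β).leadingCoeff.symm)
    rwa [hd z] at this
  · intro j _
    rw [h, eval_symPoly_symMap, Finset.prod_eq_zero (Finset.mem_univ j) (sub_self _)]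

lemma symPoly_eval_ne_zero {n : ℕ} {w : Fin n → ℂ} (hw : w ∈ symPolydisc n) {c : ℂ}
    (hc : 1 ≤ ‖c‖) : (symPoly w).eval c ≠ 0 := by
  obtain ⟨z, hz, rfl⟩ := hw
  rw [eval_symPoly_symMap, Finset.prod_ne_zero_iff]
  intro j _ h
  have := hz j
  rw [← sub_eq_zero.1 h] at this
  simp only [disc, Metric.mem_ball, dist_zero_right] at this
  linarith

end SymPolydisc
-- Zero-free holomorphic functions on a disc and Harnack's inequality.
namespace SymPolydisc
open Metric

/-- For a primitive h of g'/g with exp(h 0) = g 0, the product g · exp(-h) has zero derivative. -/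
lemma exists_exp_eq_of_ne_zero {R : ℝ} (hR : 0 < R) {g : ℂ → ℂ}
    (hg : DifferentiableOn ℂ g (ball 0 R)) (h0 : ∀ z ∈ ball (0 : ℂ) R, g z ≠ 0) :
    ∃ h : ℂ → ℂ, DifferentiableOn ℂ h (ball 0 R) ∧ ∀ z ∈ ball (0 : ℂ) R, g z = Complex.exp (h z) := by
  have hd : DifferentiableOn ℂ (fun z => deriv g z / g z) (ball 0 R) :=
    (hg.deriv isOpen_ball).div hg h0
  have hc : (0 : ℂ) ∈ ball (0 : ℂ) R := mem_ball_self hR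
  obtain ⟨h, hh0, hh⟩ := hd.isExactOn_ball.with_val_at 0 (Complex.log (g 0))
  refine ⟨h, fun z hz => (hh z hz).differentiableAt.differentiableWithinAt, fun z hz => ?_⟩
  have hderiv : ∀ z ∈ ball (0 : ℂ) R, HasDerivAt (fun z => g z * Complex.exp (-h z)) 0 z := by
    intro z hz
    have h1 := (hg.differentiableAt (isOpen_ball.mem_nhds hz)).hasDerivAt
    have h2 := h1.fun_mul (hh z hz).fun_neg.cexp
    have h3 : deriv g z * Complex.exp (-h z) +
        g z * (Complex.exp (-h z) * -(deriv g z / g z)) = 0 := by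
      have := h0 z hz
      field_simp
      ring
    rwa [h3] at h2
  have := (convex_ball (0 : ℂ) R).is_const_of_fderivWithin_eq_zero (𝕜 := ℂ)
    (f := fun z => g z * Complex.exp (-h z))
    (fun z hz => (hderiv z hz).differentiableAt.differentiableWithinAt) (fun z hz => by
      rw [fderivWithin_of_isOpen isOpen_ball hz]
      ext
      simp [(hderiv z hz).deriv]) hz hc
  simp only [hh0, Complex.exp_neg, Complex.exp_log (h0 0 hc), mul_inv_cancel₀ (h0 0 hc)] at this
  rwa [mul_inv_eq_one₀ (Complex.exp_ne_zero _)] at this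

/-- Harnack's inequality for `-log ‖g‖`, where `g` is holomorphic without zeros and `‖g‖ < 1`. -/
lemma norm_le_rpow_of_ne_zero {R : ℝ} {g : ℂ → ℂ}
    (hg : DifferentiableOn ℂ g (ball 0 R)) (h0 : ∀ z ∈ ball (0 : ℂ) R, g z ≠ 0)
    (h1 : ∀ z ∈ ball (0 : ℂ) R, ‖g z‖ < 1) {z : ℂ} (hz : z ∈ ball (0 : ℂ) R) :
    ‖g z‖ ≤ ‖g 0‖ ^ ((1 - ‖z‖ / R) / (1 + ‖z‖ / R)) := by
  have hR : 0 < R := pos_of_mem_ball hz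
  have hc : (0 : ℂ) ∈ ball (0 : ℂ) R := mem_ball_self hR
  obtain ⟨h, hh, hgh⟩ := exists_exp_eq_of_ne_zero hR hg h0
  have hre : ∀ z ∈ ball (0 : ℂ) R, (h z).re < 0 := fun z hz => by
    have := h1 z hz
    rwa [hgh z hz, Complex.norm_exp, Real.exp_lt_one_iff] at this
  set s := ‖z‖ / R with hs
  have hs0 : 0 ≤ s := by positivity
  have hs1 : s < 1 := by
    rw [hs, div_lt_one hR]
    simpa using hz
  have hden : ∀ z ∈ ball (0 : ℂ) R, h z + starRingEnd ℂ (h 0) ≠ 0 := fun z hz h' => by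
    have := congrArg Complex.re h'
    simp at this
    linarith [hre z hz, hre 0 hc]
  -- Schwarz's lemma, after the Cayley transform of the left half-plane that sends h 0 to 0.
  have key : ‖(h z - h 0) / (h z + starRingEnd ℂ (h 0))‖ ≤ s := by
    have := Complex.dist_le_div_mul_dist_of_mapsTo_ball (R₂ := 1) (c := 0) (R₁ := R)
      (f := fun z => (h z - h 0) / (h z + starRingEnd ℂ (h 0)))
      (((hh.sub_const _)).div (hh.add_const _) hden) (fun z hz => ?_) hz
    · simpa [hs, div_eq_inv_mul] using this
    · simp only [sub_self, zero_div, mem_closedBall, dist_zero_right, norm_div]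
      refine div_le_one_of_le₀ ?_ (norm_nonneg _)
      rw [← sq_le_sq₀ (norm_nonneg _) (norm_nonneg _), ← Complex.normSq_eq_norm_sq,
        ← Complex.normSq_eq_norm_sq, Complex.normSq_apply, Complex.normSq_apply]
      simp
      nlinarith [mul_pos_of_neg_of_neg (hre z hz) (hre 0 hc)]
  rw [norm_div, div_le_iff₀ (norm_pos_iff.2 (hden z hz))] at key
  have key2 : (h z).re ≤ (h 0).re * ((1 - s) / (1 + s)) := by
    have h2 := pow_le_pow_left₀ (norm_nonneg _) key 2
    rw [mul_pow, ← Complex.normSq_eq_norm_sq, ← Complex.normSq_eq_norm_sq, Complex.normSq_apply,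
      Complex.normSq_apply] at h2
    simp at h2
    -- The imaginary parts can be dropped because s² ≤ 1.
    have h3 : ((h z).re - (h 0).re) ^ 2 ≤ (s * -((h z).re + (h 0).re)) ^ 2 := by
      nlinarith [mul_nonneg (sub_nonneg.2 (pow_le_one₀ hs0 hs1.le : s ^ 2 ≤ 1))
        (sq_nonneg ((h z).im - (h 0).im))]
    have h4 := abs_le_of_sq_le_sq h3 (mul_nonneg hs0 (by linarith [hre z hz, hre 0 hc]))
    have h5 := (abs_le.1 h4).2
    rw [← mul_div_assoc, le_div_iff₀ (by linarith)]
    linarith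
  rw [hgh z hz, hgh 0 hc, Complex.norm_exp, Complex.norm_exp, ← Real.exp_mul]
  exact Real.exp_le_exp.2 key2

end SymPolydisc
-- Boundary behaviour of proper maps and propagation of relations into the disc.
namespace SymPolydisc
open Filter Topology Metric

lemma mem_disc {z : ℂ} : z ∈ disc ↔ ‖z‖ < 1 := by simp [disc]

lemma isOpen_disc : IsOpen disc := isOpen_ball

lemma polydisc_eq_ball (n : ℕ) : polydisc n = ball 0 1 := by
  ext z
  simp [polydisc, mem_disc, pi_norm_lt_iff]

lemma isOpen_polydisc (n : ℕ) : IsOpen (polydisc n) := by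
  rw [polydisc_eq_ball]
  exact isOpen_ball

lemma update_mem_polydisc {n : ℕ} {y : Fin n → ℂ} (hy : y ∈ polydisc n) (i : Fin n) {z : ℂ}
    (hz : z ∈ disc) : Function.update y i z ∈ polydisc n := by
  intro j
  by_cases h : j = i
  · subst h
    simpa using hz
  · simpa [h] using hy j

lemma differentiable_update {n : ℕ} (y : Fin n → ℂ) (i : Fin n) :
    Differentiable ℂ (fun z : ℂ => Function.update y i z) := fun z =>
  (hasFDerivAt_update y z).differentiableAt

/-- By the maximum principle, a value of `g` is dominated in norm along a sequence that tends to
the unit circle. -/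
lemma exists_seq_norm_le {g : ℂ → ℂ} (hg : DifferentiableOn ℂ g disc) {z₀ : ℂ} (hz₀ : z₀ ∈ disc) :
    ∃ z : ℕ → ℂ, (∀ k, z k ∈ disc) ∧ Tendsto (fun k => ‖z k‖) atTop (𝓝 1) ∧
      ∀ k, ‖g z₀‖ ≤ ‖g (z k)‖ := by
  rw [mem_disc] at hz₀
  -- These radii increase to 1; the denominator k + 2 keeps even the first one strictly above ‖z₀‖.
  have hr : ∀ k : ℕ, ∃ z : ℂ, ‖z‖ = 1 - (1 - ‖z₀‖) * (1 / ((k : ℝ) + 1 + 1)) ∧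
      ‖g z₀‖ ≤ ‖g z‖ := by
    intro k
    have h1 : 0 < 1 / ((k : ℝ) + 1 + 1) := by positivity
    have h2 : 1 / ((k : ℝ) + 1 + 1) < 1 := by
      rw [div_lt_one (by positivity)]
      have : (0 : ℝ) ≤ k := k.cast_nonneg
      linarith
    set r := 1 - (1 - ‖z₀‖) * (1 / ((k : ℝ) + 1 + 1)) with hrdef
    have hr1 : r < 1 := by nlinarith
    have hr0 : ‖z₀‖ < r := by nlinarith
    have hrpos : 0 < r := (norm_nonneg _).trans_lt hr0
    have hd : DiffContOnCl ℂ g (ball 0 r) := by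
      apply DifferentiableOn.diffContOnCl
      rw [closure_ball _ hrpos.ne']
      exact hg.mono (closedBall_subset_ball hr1)
    obtain ⟨z, hz, hmax⟩ := Complex.exists_mem_frontier_isMaxOn_norm isBounded_ball
      (nonempty_ball.2 hrpos) hd
    rw [frontier_ball _ hrpos.ne', mem_sphere_zero_iff_norm] at hz
    exact ⟨z, hz, hmax (subset_closure (by simpa using hr0))⟩
  choose z hz hz' using hr
  refine ⟨z, fun k => ?_, ?_, hz'⟩
  · rw [mem_disc, hz]
    have : 0 < (1 - ‖z₀‖) * (1 / ((k : ℝ) + 1 + 1)) := mul_pos (by linarith) (by positivity)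
    linarith
  · simp_rw [hz]
    have := (tendsto_one_div_add_atTop_nhds_zero_nat (𝕜 := ℝ)).comp (tendsto_add_atTop_nat 1)
    simpa using (this.const_mul (1 - ‖z₀‖)).const_sub 1

/-- Properness of a map `A → B`, in terms of ultrafilters. -/
def ProperOn {X Y : Type*} [TopologicalSpace X] [TopologicalSpace Y] (F : X → Y) (A : Set X)
    (B : Set Y) : Prop :=
  ∀ 𝒰 : Ultrafilter X, A ∈ 𝒰 → ∀ y ∈ B, Tendsto F 𝒰 (𝓝 y) → ∃ x ∈ A, (𝒰 : Filter X) ≤ 𝓝 x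

/-- Proper holomorphic maps from the polydisc to the symmetrized polydisc. -/
structure IsProperHol {n : ℕ} (F : (Fin n → ℂ) → (Fin n → ℂ)) : Prop where
  diff : DifferentiableOn ℂ F (polydisc n)
  maps : Set.MapsTo F (polydisc n) (symPolydisc n)
  proper : ProperOn F (polydisc n) (symPolydisc n)

lemma exists_ultrafilter_tendsto {n : ℕ} {α : Type*} (𝒰 : Ultrafilter α) {μ : α → Fin n → ℂ}
    (hμ : ∀ a, μ a ∈ polydisc n) : ∃ μ₀ : Fin n → ℂ, (∀ j, ‖μ₀ j‖ ≤ 1) ∧ Tendsto μ 𝒰 (𝓝 μ₀) := by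
  obtain ⟨μ₀, h1, h2⟩ := (isCompact_closedBall (0 : Fin n → ℂ) 1).ultrafilter_le_nhds (𝒰.map μ) (by
    rw [le_principal_iff, Ultrafilter.coe_map, mem_map]
    refine univ_mem' fun a => ?_
    have := hμ a
    rw [polydisc_eq_ball] at this
    exact ball_subset_closedBall this)
  refine ⟨μ₀, fun j => ?_, h2⟩
  rw [mem_closedBall_zero_iff] at h1
  exact (norm_le_pi_norm _ j).trans h1

lemma norm_eval_symPoly_le {n : ℕ} {w : Fin n → ℂ} (hw : w ∈ symPolydisc n) {c : ℂ} (hc : ‖c‖ = 1) :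
    ‖(symPoly w).eval c‖ ≤ 2 ^ n := by
  obtain ⟨z, hz, rfl⟩ := hw
  rw [eval_symPoly_symMap, norm_prod]
  refine (Finset.prod_le_prod (g := fun _ => (2 : ℝ)) (fun _ _ => norm_nonneg _)
    fun j _ => ?_).trans (by simp)
  have := mem_disc.1 (hz j)
  linarith [norm_sub_le c (z j)]

lemma differentiable_eval_symPoly {n : ℕ} (c : ℂ) :
    Differentiable ℂ (fun w : Fin n → ℂ => (symPoly w).eval c) := by
  simp_rw [symPoly_eval]
  have := differentiable_pi.1 (differentiable_coeffVec n)
  fun_prop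

/-- When one variable tends to the unit circle, the values of a proper holomorphic map
acquire a common unimodular root. -/
lemma IsProperHol.exists_common_root {n : ℕ} {F : (Fin n → ℂ) → (Fin n → ℂ)} (hF : IsProperHol F)
    {α : Type*} (𝒰 : Ultrafilter α) {z : α → ℂ} (hz : ∀ a, z a ∈ disc)
    (hz1 : Tendsto (fun a => ‖z a‖) 𝒰 (𝓝 1)) (i : Fin n) :
    ∃ c : ℂ, ‖c‖ = 1 ∧ ∀ y ∈ polydisc n, ∃ w : Fin n → ℂ,
      Tendsto (fun a => F (Function.update y i (z a))) 𝒰 (𝓝 w) ∧ (symPoly w).eval c = 0 := by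
  have lim : ∀ y ∈ polydisc n, ∃ μ : Fin n → ℂ, (∀ j, ‖μ j‖ ≤ 1) ∧
      Tendsto (fun a => F (Function.update y i (z a))) 𝒰 (𝓝 (symMap n μ)) := by
    intro y hy
    have hm : ∀ a, ∃ μ ∈ polydisc n, symMap n μ = F (Function.update y i (z a)) := fun a =>
      hF.maps (update_mem_polydisc hy i (hz a))
    choose μ hμ hμ' using hm
    obtain ⟨μ₀, h1, h2⟩ := exists_ultrafilter_tendsto 𝒰 hμ
    refine ⟨μ₀, h1, ?_⟩
    simp_rw [← hμ']
    exact ((differentiable_symMap n).continuous.tendsto μ₀).comp h2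
  have h0 : (0 : Fin n → ℂ) ∈ polydisc n := fun j => by simp [mem_disc]
  obtain ⟨μ, hμ, hμlim⟩ := lim 0 h0
  -- Otherwise the limit lies in the target, and properness yields a limit point in the polydisc
  -- whose i-th coordinate has modulus 1.
  obtain ⟨j, hj⟩ : ∃ j, ‖μ j‖ = 1 := by
    by_contra! hcon
    have hμ' : μ ∈ polydisc n := fun j => mem_disc.2 (lt_of_le_of_ne (hμ j) (hcon j))
    obtain ⟨x, hx, hxlim⟩ := hF.proper (𝒰.map fun a => Function.update 0 i (z a))
      (by
        rw [Ultrafilter.mem_map]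
        exact univ_mem' fun a => update_mem_polydisc h0 i (hz a)) _ ⟨μ, hμ', rfl⟩ hμlim
    have h1 : Tendsto (fun a => ‖(Function.update 0 i (z a) : Fin n → ℂ) i‖) 𝒰 (𝓝 ‖x i‖) :=
      ((continuous_norm.comp (continuous_apply (A := fun _ : Fin n => ℂ) i)).tendsto x).comp
        (show Tendsto (fun a => Function.update (0 : Fin n → ℂ) i (z a)) 𝒰 (𝓝 x) from hxlim)
    simp only [Function.update_self] at h1
    have := tendsto_nhds_unique h1 hz1
    have := mem_disc.1 (hx i)
    linarith
  refine ⟨μ j, hj, fun y hy => ?_⟩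
  obtain ⟨ν, -, hνlim⟩ := lim y hy
  refine ⟨_, hνlim, ?_⟩
  have hev : ∀ {y : Fin n → ℂ} {w : Fin n → ℂ},
      Tendsto (fun a => F (Function.update y i (z a))) 𝒰 (𝓝 w) →
      Tendsto (fun a => ‖(symPoly (F (Function.update y i (z a)))).eval (μ j) / (2 * 2 ^ n)‖) 𝒰
        (𝓝 ‖(symPoly w).eval (μ j) / (2 * 2 ^ n)‖) := fun {y w} h =>
    ((((differentiable_eval_symPoly (μ j)).continuous.div_const _).norm).tendsto w).comp h
  have hy1 : ‖y‖ < 1 := by simpa [polydisc_eq_ball] using hy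
  -- R exceeds 1, yet ζ • y stays in the polydisc for ‖ζ‖ < R, so 0 and y are joined by a disc
  -- having 1 in its interior.
  set R := 2 / (1 + ‖y‖) with hRdef
  have hR1 : 1 < R := by
    rw [hRdef, lt_div_iff₀ (by positivity)]
    linarith
  have hRy : R * ‖y‖ < 1 := by
    rw [hRdef, div_mul_eq_mul_div, div_lt_one (by positivity)]
    linarith
  set κ := (1 - ‖(1 : ℂ)‖ / R) / (1 + ‖(1 : ℂ)‖ / R) with hκ
  have hκ0 : 0 < κ := by
    have : ‖(1 : ℂ)‖ / R < 1 := by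
      rw [norm_one, div_lt_one (by positivity)]
      exact hR1
    apply div_pos
    · linarith
    · have : 0 ≤ ‖(1 : ℂ)‖ / R := by positivity
      linarith
  -- Harnack along ζ ↦ ζ • y, with an exponent independent of `a`. Values at a unimodular point are
  -- nonzero and at most 2ⁿ in norm; the extra factor 2 makes the bound strict. Vanishing in the
  -- limit at 0 thus forces vanishing in the limit at y.
  have hle : ∀ a, ‖(symPoly (F (Function.update y i (z a)))).eval (μ j) / (2 * 2 ^ n)‖ ≤
      ‖(symPoly (F (Function.update 0 i (z a)))).eval (μ j) / (2 * 2 ^ n)‖ ^ κ := by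
    intro a
    have hmem : ∀ ζ ∈ ball (0 : ℂ) R, Function.update (ζ • y) i (z a) ∈ polydisc n := by
      intro ζ hζ
      refine update_mem_polydisc ?_ i (hz a)
      rw [polydisc_eq_ball, mem_ball_zero_iff, norm_smul]
      refine lt_of_le_of_lt ?_ hRy
      gcongr
      exact (mem_ball_zero_iff.1 hζ).le
    have hupd : Differentiable ℂ (fun ζ : ℂ => Function.update (ζ • y) i (z a)) := by
      rw [differentiable_pi]
      intro k
      by_cases hk : k = i
      · subst hk
        simp
      · simp only [Function.update_of_ne hk, Pi.smul_apply]
        fun_prop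
    have := norm_le_rpow_of_ne_zero (R := R) (z := 1)
      (g := fun ζ => (symPoly (F (Function.update (ζ • y) i (z a)))).eval (μ j) / (2 * 2 ^ n))
      ?_ ?_ ?_ (by simpa using hR1)
    · simpa only [one_smul, zero_smul] using this
    · exact ((differentiable_eval_symPoly (μ j)).comp_differentiableOn
        (hF.diff.comp hupd.differentiableOn hmem)).div_const _
    · intro ζ hζ
      exact div_ne_zero (symPoly_eval_ne_zero (hF.maps (hmem ζ hζ)) hj.ge)
        (mul_ne_zero two_ne_zero (pow_ne_zero _ two_ne_zero))
    · intro ζ hζ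
      have h2 := norm_eval_symPoly_le (hF.maps (hmem ζ hζ)) hj
      have h3 : (0 : ℝ) < 2 ^ n := by positivity
      rw [norm_div]
      simp only [norm_mul, norm_pow, Complex.norm_ofNat]
      rw [div_lt_one (by positivity)]
      linarith
  have h2 := (hev hμlim).rpow_const (p := κ) (Or.inr hκ0.le)
  have h3 := le_of_tendsto_of_tendsto' (hev hνlim) h2 hle
  rw [eval_symPoly_symMap μ, Finset.prod_eq_zero (Finset.mem_univ j) (sub_self (μ j)), zero_div,
    norm_zero, Real.zero_rpow hκ0.ne', norm_le_zero_iff, div_eq_zero_iff] at h3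
  exact h3.resolve_right (mul_ne_zero two_ne_zero (pow_ne_zero _ two_ne_zero))

/-- A polynomial relation between the coefficient vectors of the values of a proper holomorphic
map that holds in the presence of a common unimodular root holds identically. -/
lemma IsProperHol.relation_eq_zero {n : ℕ} {F : (Fin n → ℂ) → (Fin n → ℂ)} (hF : IsProperHol F)
    {κ : Type*} [Fintype κ] {q : (κ → Fin (n + 1) → ℂ) → ℂ} (hq : Differentiable ℂ q)
    {V : Set (Fin (n + 1) → ℂ)} (hV : IsClosed V) (i : Fin n) {y : κ → Fin n → ℂ}
    (hy : ∀ k, y k ∈ polydisc n)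
    (hyV : ∀ k, ∀ z ∈ disc, coeffVec (F (Function.update (y k) i z)) ∈ V)
    (hq0 : ∀ r : κ → Fin (n + 1) → ℂ, (∀ k, r k ∈ V) → ∀ c : ℂ, ‖c‖ = 1 →
      (∀ k, ∑ l, r k l * c ^ (l : ℕ) = 0) → q r = 0) {z : ℂ} (hz : z ∈ disc) :
    q (fun k => coeffVec (F (Function.update (y k) i z))) = 0 := by
  have hd : DifferentiableOn ℂ (fun z => q (fun k => coeffVec (F (Function.update (y k) i z))))
      disc := by
    refine hq.comp_differentiableOn (differentiableOn_pi.2 fun k => ?_)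
    exact (differentiable_coeffVec n).comp_differentiableOn (hF.diff.comp
      (differentiable_update _ _).differentiableOn fun z hz => update_mem_polydisc (hy k) i hz)
  obtain ⟨s, hs, hs1, hsle⟩ := exists_seq_norm_le hd hz
  obtain ⟨c, hc, hlim⟩ := hF.exists_common_root (hyperfilter ℕ) hs
    (hs1.mono_left Nat.hyperfilter_le_atTop) i
  choose w hw hwc using fun k => hlim (y k) (hy k)
  have hcv : ∀ k, Tendsto (fun a => coeffVec (F (Function.update (y k) i (s a)))) (hyperfilter ℕ)
      (𝓝 (coeffVec (w k))) := fun k =>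
    ((differentiable_coeffVec n).continuous.tendsto (w k)).comp (hw k)
  have hzero : q (fun k => coeffVec (w k)) = 0 := by
    refine hq0 _ (fun k => hV.mem_of_tendsto (hcv k) ?_) c hc fun k => ?_
    · exact Eventually.of_forall fun a => hyV k _ (hs a)
    · rw [← symPoly_eval]
      exact hwc k
  have ht : Tendsto (fun a => ‖q (fun k => coeffVec (F (Function.update (y k) i (s a))))‖)
      (hyperfilter ℕ) (𝓝 ‖q (fun k => coeffVec (w k))‖) :=
    ((hq.continuous.norm).tendsto _).comp (tendsto_pi_nhds.2 hcv)
  have := ge_of_tendsto' ht hsle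
  rw [hzero, norm_zero] at this
  exact norm_le_zero_iff.1 this

end SymPolydisc
-- Dimension count for the spans of slices.
namespace SymPolydisc
open Module

lemma differentiable_det {E : Type*} [NormedAddCommGroup E] [NormedSpace ℂ E] {m : Type*}
    [Fintype m] [DecidableEq m] {M : E → Matrix m m ℂ}
    (hM : ∀ k l, Differentiable ℂ (fun x => M x k l)) : Differentiable ℂ (fun x => (M x).det) := by
  simp_rw [Matrix.det_apply]
  refine Differentiable.fun_sum fun σ _ => Differentiable.fun_const_smul ?_ _
  induction (Finset.univ : Finset m) using Finset.induction_on with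
  | empty => simp
  | insert a s ha ih =>
    simp_rw [Finset.prod_insert ha]
    exact (hM _ _).fun_mul ih

/-- The slice of the polydisc on which the variables outside `T` are frozen to those of `x`. -/
def slice {n : ℕ} (T : Finset (Fin n)) (x : Fin n → ℂ) : Set (Fin n → ℂ) :=
  {μ | μ ∈ polydisc n ∧ ∀ j ∉ T, μ j = x j}

/-- The span of the coefficient vectors of the values of `F` on a slice. -/
noncomputable def sliceSpan {n : ℕ} (F : (Fin n → ℂ) → (Fin n → ℂ)) (T : Finset (Fin n))
    (x : Fin n → ℂ) : Submodule ℂ (Fin (n + 1) → ℂ) :=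
  Submodule.span ℂ ((fun μ => coeffVec (F μ)) '' slice T x)

lemma coeffVec_mem_sliceSpan {n : ℕ} (F : (Fin n → ℂ) → (Fin n → ℂ)) {T : Finset (Fin n)}
    {x μ : Fin n → ℂ} (hμ : μ ∈ slice T x) : coeffVec (F μ) ∈ sliceSpan F T x :=
  Submodule.subset_span ⟨μ, hμ, rfl⟩

/-- Evaluation at `c` of the polynomial with a given coefficient vector. -/
noncomputable def evalCoeff (n : ℕ) (c : ℂ) : (Fin (n + 1) → ℂ) →ₗ[ℂ] ℂ :=
  ∑ l : Fin (n + 1), c ^ (l : ℕ) • LinearMap.proj l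

lemma evalCoeff_apply {n : ℕ} (c : ℂ) (r : Fin (n + 1) → ℂ) :
    evalCoeff n c r = ∑ l, r l * c ^ (l : ℕ) := by
  simp [evalCoeff, mul_comm]

lemma eval_symPoly_eq {n : ℕ} (w : Fin n → ℂ) (c : ℂ) :
    (symPoly w).eval c = evalCoeff n c (coeffVec w) := by
  rw [symPoly_eval, evalCoeff_apply]

/-- If the spans agreed, a basis from the smaller slice would have coordinate determinant 1. Moving
the i-th variable keeps the vectors in the span; if they acquire a common unimodular root they
cannot be a basis, since the span contains the polynomial of `F x`, which has no such root. So the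
determinant would vanish identically. -/
lemma IsProperHol.finrank_sliceSpan_erase_lt {n : ℕ} {F : (Fin n → ℂ) → (Fin n → ℂ)}
    (hF : IsProperHol F) {T : Finset (Fin n)} {i : Fin n} (hi : i ∈ T) {x : Fin n → ℂ}
    (hx : x ∈ polydisc n) :
    finrank ℂ (sliceSpan F (T.erase i) x) < finrank ℂ (sliceSpan F T x) := by
  have hsub : slice (T.erase i) x ⊆ slice T x := fun μ hμ =>
    ⟨hμ.1, fun j hj => hμ.2 j fun h => hj (Finset.mem_of_mem_erase h)⟩
  have hle : sliceSpan F (T.erase i) x ≤ sliceSpan F T x :=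
    Submodule.span_mono (Set.image_mono hsub)
  by_contra hcon
  have heq : sliceSpan F (T.erase i) x = sliceSpan F T x :=
    Submodule.eq_of_le_of_finrank_le hle (not_lt.1 hcon)
  obtain ⟨f, hfmem, hfspan, hfli⟩ := Submodule.exists_fun_fin_finrank_span_eq ℂ
    ((fun μ => coeffVec (F μ)) '' slice (T.erase i) x)
  change Submodule.span ℂ (Set.range f) = sliceSpan F (T.erase i) x at hfspan
  choose y hy hyf using hfmem
  -- `g` reads off coordinates in the basis `f`, extended linearly to the whole space so that it
  -- stays holomorphic.
  obtain ⟨g, hg⟩ := (Fintype.linearCombination ℂ f).exists_leftInverse_of_injective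
    (LinearMap.ker_eq_bot.2 (linearIndependent_iff_injective_fintypeLinearCombination.1 hfli))
  have hgf : ∀ k, g (f k) = Pi.single k 1 := fun k => by
    have := LinearMap.congr_fun hg (Pi.single k 1)
    simpa [Fintype.linearCombination_apply_single] using this
  have hgd : Differentiable ℂ g := g.toContinuousLinearMap.differentiable
  have hq : Differentiable ℂ (fun r : Fin (finrank ℂ (sliceSpan F (T.erase i) x)) →
      Fin (n + 1) → ℂ => Matrix.det (Matrix.of fun k => g (r k))) := by
    refine differentiable_det fun k l => ?_
    exact differentiable_pi.1 (hgd.comp (differentiable_apply k)) l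
  have hdet := hF.relation_eq_zero hq (V := sliceSpan F T x)
    (Submodule.closed_of_finiteDimensional _) i (fun k => (hy k).1) (fun k z hz => ?_)
    (fun r hrV c hc hrc => ?_) (hx i)
  · have hup : ∀ k, Function.update (y k) i (x i) = y k := fun k => by
      rw [← (hy k).2 i (Finset.notMem_erase i T), Function.update_eq_self]
    simp only [hup] at hdet
    have h1 : (Matrix.of fun k => g (coeffVec (F (y k)))) = 1 := by
      ext k l
      simp only [Matrix.of_apply, Matrix.one_apply]
      rw [show coeffVec (F (y k)) = f k from hyf k, hgf, Pi.single_apply]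
      simp only [eq_comm]
    rw [h1, Matrix.det_one] at hdet
    exact one_ne_zero hdet
  · refine coeffVec_mem_sliceSpan F ⟨update_mem_polydisc (hy k).1 i hz, fun j hj => ?_⟩
    have hji : j ≠ i := fun h => hj (h ▸ hi)
    rw [Function.update_of_ne hji]
    exact (hy k).2 j fun h => hj (Finset.mem_of_mem_erase h)
  · by_contra hne
    have hli : LinearIndependent ℂ r := by
      have h1 : LinearIndependent ℂ (Matrix.of fun k => g (r k)).row :=
        Matrix.linearIndependent_rows_iff_isUnit.2
          ((Matrix.isUnit_iff_isUnit_det _).2 (isUnit_iff_ne_zero.2 hne))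
      exact LinearIndependent.of_comp g h1
    have hspan : Submodule.span ℂ (Set.range r) = sliceSpan F T x := by
      apply Submodule.eq_of_le_of_finrank_le
      · rw [Submodule.span_le]
        rintro _ ⟨k, rfl⟩
        exact hrV k
      · rw [finrank_span_eq_card hli, Fintype.card_fin, heq]
    have hker : sliceSpan F T x ≤ LinearMap.ker (evalCoeff n c) := by
      rw [← hspan, Submodule.span_le]
      rintro _ ⟨k, rfl⟩
      rw [SetLike.mem_coe, LinearMap.mem_ker, evalCoeff_apply]
      exact hrc k
    have := hker (coeffVec_mem_sliceSpan F (⟨hx, fun _ _ => rfl⟩ : x ∈ slice T x))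
    rw [LinearMap.mem_ker, ← eval_symPoly_eq] at this
    exact symPoly_eval_ne_zero (hF.maps hx) hc.ge this

lemma IsProperHol.card_lt_finrank_sliceSpan {n : ℕ} {F : (Fin n → ℂ) → (Fin n → ℂ)}
    (hF : IsProperHol F) (T : Finset (Fin n)) {x : Fin n → ℂ} (hx : x ∈ polydisc n) :
    T.card < finrank ℂ (sliceSpan F T x) := by
  induction T using Finset.induction_on with
  | empty =>
    rw [Finset.card_empty, Nat.pos_iff_ne_zero, Ne, Submodule.finrank_eq_zero, Submodule.eq_bot_iff]
    intro h
    have := h _ (coeffVec_mem_sliceSpan F (⟨hx, fun _ _ => rfl⟩ : x ∈ slice ∅ x))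
    have h1 := coeffVec_last (F x)
    simp [this] at h1
  | insert i T hi ih =>
    rw [Finset.card_insert_of_notMem hi]
    have := hF.finrank_sliceSpan_erase_lt (Finset.mem_insert_self i T) hx
    rw [Finset.erase_insert hi] at this
    omega

lemma IsProperHol.sliceSpan_univ {n : ℕ} {F : (Fin n → ℂ) → (Fin n → ℂ)}
    (hF : IsProperHol F) {x : Fin n → ℂ} (hx : x ∈ polydisc n) :
    sliceSpan F Finset.univ x = ⊤ := by
  apply Submodule.eq_top_of_finrank_eq
  have h1 := hF.card_lt_finrank_sliceSpan Finset.univ hx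
  have h2 := Submodule.finrank_le (sliceSpan F Finset.univ x)
  simp only [Finset.card_univ, Fintype.card_fin, finrank_fin_fun] at *
  omega

/-- The dimension is squeezed strictly between n - 1 and n + 1. -/
lemma IsProperHol.finrank_sliceSpan_erase {n : ℕ} {F : (Fin n → ℂ) → (Fin n → ℂ)}
    (hF : IsProperHol F) (i : Fin n) {x : Fin n → ℂ} (hx : x ∈ polydisc n) :
    finrank ℂ (sliceSpan F (Finset.univ.erase i) x) = n := by
  have h1 := hF.card_lt_finrank_sliceSpan (Finset.univ.erase i) hx
  have h2 := hF.finrank_sliceSpan_erase_lt (Finset.mem_univ i) hx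
  rw [hF.sliceSpan_univ hx, finrank_top, finrank_fin_fun] at h2
  rw [Finset.card_erase_of_mem (Finset.mem_univ i)] at h1
  simp only [Finset.card_univ, Fintype.card_fin] at h1
  omega

end SymPolydisc
-- Cofactors as the normal vector of a hyperplane.
namespace SymPolydisc
open Module Filter Topology

/-- The signed maximal minors of an `n × (n + 1)` matrix with rows `r`. -/
noncomputable def cofactors {n : ℕ} (r : Fin n → Fin (n + 1) → ℂ) (l : Fin (n + 1)) : ℂ :=
  (-1) ^ (l : ℕ) * ((Matrix.of r).submatrix id l.succAbove).det

lemma sum_mul_cofactors {n : ℕ} (r : Fin n → Fin (n + 1) → ℂ) (w : Fin (n + 1) → ℂ) :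
    ∑ l, w l * cofactors r l =
      (Matrix.of (Fin.cons w r : Fin (n + 1) → Fin (n + 1) → ℂ)).det := by
  rw [Matrix.det_succ_row_zero]
  refine Finset.sum_congr rfl fun l _ => ?_
  have : (Matrix.of (Fin.cons w r : Fin (n + 1) → Fin (n + 1) → ℂ)).submatrix Fin.succ l.succAbove
      = (Matrix.of r).submatrix id l.succAbove := by
    ext a b
    simp
  rw [cofactors, this]
  simp
  ring

lemma differentiable_cofactors {n : ℕ} (l : Fin (n + 1)) :
    Differentiable ℂ (fun r : Fin n → Fin (n + 1) → ℂ => cofactors r l) := by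
  refine Differentiable.const_mul (differentiable_det fun a b => ?_) _
  simp only [Matrix.submatrix_apply, Matrix.of_apply, id]
  fun_prop

lemma det_cons_ne_zero_iff {n : ℕ} (r : Fin n → Fin (n + 1) → ℂ) (w : Fin (n + 1) → ℂ) :
    (Matrix.of (Fin.cons w r : Fin (n + 1) → Fin (n + 1) → ℂ)).det ≠ 0 ↔
      LinearIndependent ℂ r ∧ w ∉ Submodule.span ℂ (Set.range r) := by
  rw [← linearIndependent_finCons, ← isUnit_iff_ne_zero, ← Matrix.isUnit_iff_isUnit_det,
    ← Matrix.linearIndependent_rows_iff_isUnit]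
  rfl

lemma sum_mul_cofactors_eq_zero {n : ℕ} {r : Fin n → Fin (n + 1) → ℂ} {w : Fin (n + 1) → ℂ}
    (hw : w ∈ Submodule.span ℂ (Set.range r)) : ∑ l, w l * cofactors r l = 0 := by
  rw [sum_mul_cofactors]
  by_contra h
  exact ((det_cons_ne_zero_iff r w).1 h).2 hw

lemma cofactors_ne_zero_iff {n : ℕ} (r : Fin n → Fin (n + 1) → ℂ) :
    cofactors r ≠ 0 ↔ LinearIndependent ℂ r := by
  constructor
  · intro h
    obtain ⟨l, hl⟩ := Function.ne_iff.1 h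
    refine ((det_cons_ne_zero_iff r (Pi.single l 1)).1 ?_).1
    rw [← sum_mul_cofactors]
    simpa [Pi.single_apply] using hl
  · intro h h0
    have hlt : Submodule.span ℂ (Set.range r) < ⊤ := by
      apply Submodule.lt_top_of_finrank_lt_finrank
      rw [finrank_span_eq_card h]
      simp
    obtain ⟨w, -, hw⟩ := SetLike.exists_of_lt hlt
    refine (det_cons_ne_zero_iff r w).2 ⟨h, hw⟩ ?_
    rw [← sum_mul_cofactors, h0]
    simp

/-- The vector (1, c, …, cⁿ) is killed by every row of `r` and by e_l - cˡ e₀, so the square matrix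
they form is singular; its determinant is the asserted difference. -/
lemma cofactors_eq_pow_mul {n : ℕ} {r : Fin n → Fin (n + 1) → ℂ} {c : ℂ}
    (h : ∀ k, ∑ l, r k l * c ^ (l : ℕ) = 0) (l : Fin (n + 1)) :
    cofactors r l = c ^ (l : ℕ) * cofactors r 0 := by
  have hdet : (Matrix.of (Fin.cons (Pi.single l 1 - c ^ (l : ℕ) • Pi.single 0 1) r :
      Fin (n + 1) → Fin (n + 1) → ℂ)).det = 0 := by
    rw [← Matrix.exists_mulVec_eq_zero_iff]
    refine ⟨fun m => c ^ (m : ℕ), fun h0 => ?_, ?_⟩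
    · simpa using congrFun h0 0
    · ext k
      refine Fin.cases ?_ (fun k => ?_) k
      · simp [Matrix.mulVec, dotProduct, Pi.single_apply, sub_mul]
      · simpa [Matrix.mulVec, dotProduct] using h k
  rw [← sum_mul_cofactors] at hdet
  simp [Pi.single_apply, sub_mul] at hdet
  linear_combination hdet

/-- The Veronese relations force a nonzero vector of cofactors to be geometric. -/
lemma cofactors_geometric {n : ℕ} {r : Fin n → Fin (n + 1) → ℂ} (hr : LinearIndependent ℂ r)
    (k₀ : Fin n) (hlast : r k₀ (Fin.last n) = 1)
    (hrel : ∀ a b c d : Fin (n + 1), (a : ℕ) + b = c + d →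
      cofactors r a * cofactors r b = cofactors r c * cofactors r d) :
    cofactors r 0 ≠ 0 ∧ ∃ o : Fin (n + 1), (o : ℕ) = 1 ∧ ∀ l : Fin (n + 1),
      cofactors r l = cofactors r 0 * (cofactors r o / cofactors r 0) ^ (l : ℕ) := by
  have hn : 0 < n := k₀.pos
  have h0 : cofactors r 0 ≠ 0 := by
    intro h0
    -- The relation (l+1) + (l+1) = l + (l+2) propagates the zero, but only up to index n - 1; the
    -- last cofactor vanishes because row k₀ has last entry 1.
    have hz : ∀ l : ℕ, ∀ hl : l < n, cofactors r ⟨l, by omega⟩ = 0 := by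
      intro l
      induction l with
      | zero => exact fun _ => h0
      | succ l ih =>
        intro hl
        have := hrel ⟨l + 1, by omega⟩ ⟨l + 1, by omega⟩ ⟨l, by omega⟩ ⟨l + 2, by omega⟩
          (by simp only; omega)
        rw [ih (by omega), zero_mul] at this
        exact mul_self_eq_zero.1 this
    have hs := sum_mul_cofactors_eq_zero (Submodule.subset_span (Set.mem_range_self k₀) :
      r k₀ ∈ Submodule.span ℂ (Set.range r))
    rw [Fin.sum_univ_castSucc, Finset.sum_eq_zero, hlast, zero_add, one_mul] at hs
    · refine (cofactors_ne_zero_iff r).2 hr ?_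
      ext l
      refine Fin.lastCases hs (fun l => hz l l.2) l
    · intro l _
      rw [show cofactors r l.castSucc = 0 from hz l l.2, mul_zero]
  refine ⟨h0, ⟨1, by omega⟩, rfl, ?_⟩
  rintro ⟨l, hl⟩
  induction l with
  | zero => simp
  | succ l ih =>
    have h1 := ih (by omega)
    have h2 := hrel 0 ⟨l + 1, hl⟩ ⟨1, by omega⟩ ⟨l, by omega⟩ (by simp; omega)
    simp only at h1 ⊢
    rw [h1] at h2
    apply mul_left_cancel₀ h0
    rw [h2, pow_succ]
    field_simp

/-! ### The root function of one variable. -/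

lemma mem_slice_erase {n : ℕ} {i : Fin n} {x μ : Fin n → ℂ} :
    μ ∈ slice (Finset.univ.erase i) x ↔ μ ∈ polydisc n ∧ μ i = x i := by
  simp [slice]

lemma zero_mem_polydisc (n : ℕ) : (0 : Fin n → ℂ) ∈ polydisc n := fun j => by simp [mem_disc]

lemma IsProperHol.exists_independent {n : ℕ} {F : (Fin n → ℂ) → (Fin n → ℂ)} (hF : IsProperHol F)
    (i : Fin n) {z : ℂ} (hz : z ∈ disc) :
    ∃ y : Fin n → Fin n → ℂ, (∀ k, y k ∈ polydisc n ∧ y k i = z) ∧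
      LinearIndependent ℂ (fun k => coeffVec (F (y k))) := by
  have hx := update_mem_polydisc (zero_mem_polydisc n) i hz
  have hex := Submodule.exists_fun_fin_finrank_span_eq ℂ
    ((fun μ => coeffVec (F μ)) '' slice (Finset.univ.erase i) (Function.update 0 i z))
  have hfr := hF.finrank_sliceSpan_erase i hx
  rw [sliceSpan] at hfr
  rw [hfr] at hex
  obtain ⟨f, hfmem, -, hfli⟩ := hex
  choose y hy hyf using hfmem
  refine ⟨y, fun k => ?_, ?_⟩
  · have := mem_slice_erase.1 (hy k)
    simpa using this
  · rw [show (fun k => coeffVec (F (y k))) = f from funext hyf]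
    exact hfli

lemma IsProperHol.mem_span_of_independent {n : ℕ} {F : (Fin n → ℂ) → (Fin n → ℂ)}
    (hF : IsProperHol F) {i : Fin n} {z : ℂ} {y : Fin n → Fin n → ℂ}
    (hy : ∀ k, y k ∈ polydisc n ∧ y k i = z)
    (hli : LinearIndependent ℂ (fun k => coeffVec (F (y k)))) {μ : Fin n → ℂ}
    (hμ : μ ∈ polydisc n) (hμi : μ i = z) :
    coeffVec (F μ) ∈ Submodule.span ℂ (Set.range fun k => coeffVec (F (y k))) := by
  have : Submodule.span ℂ (Set.range fun k => coeffVec (F (y k))) =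
      sliceSpan F (Finset.univ.erase i) μ := by
    apply Submodule.eq_of_le_of_finrank_le
    · rw [Submodule.span_le]
      rintro _ ⟨k, rfl⟩
      exact coeffVec_mem_sliceSpan F (mem_slice_erase.2 ⟨(hy k).1, (hy k).2.trans hμi.symm⟩)
    · rw [finrank_span_eq_card hli, hF.finrank_sliceSpan_erase i hμ, Fintype.card_fin]
  rw [this]
  exact coeffVec_mem_sliceSpan F (mem_slice_erase.2 ⟨hμ, rfl⟩)

/-- A common root is the ratio of the first two cofactors of an independent family. Uniqueness lets
the local roots glue. -/
lemma IsProperHol.common_root_unique {n : ℕ} {F : (Fin n → ℂ) → (Fin n → ℂ)} (hF : IsProperHol F)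
    (i : Fin n) {z : ℂ} (hz : z ∈ disc) {b b' : ℂ}
    (hb : ∀ μ ∈ polydisc n, μ i = z → (symPoly (F μ)).eval b = 0)
    (hb' : ∀ μ ∈ polydisc n, μ i = z → (symPoly (F μ)).eval b' = 0) : b = b' := by
  obtain ⟨y, hy, hli⟩ := hF.exists_independent i hz
  have h1 := fun l => cofactors_eq_pow_mul (c := b) (r := fun k => coeffVec (F (y k)))
    (fun k => by rw [← symPoly_eval]; exact hb _ (hy k).1 (hy k).2) l
  have h2 := fun l => cofactors_eq_pow_mul (c := b') (r := fun k => coeffVec (F (y k)))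
    (fun k => by rw [← symPoly_eval]; exact hb' _ (hy k).1 (hy k).2) l
  have h0 : cofactors (fun k => coeffVec (F (y k))) 0 ≠ 0 := by
    intro h0
    refine (cofactors_ne_zero_iff _).2 hli ?_
    ext l
    rw [h1, h0, mul_zero, Pi.zero_apply]
  have h3 := (h1 ⟨1, by have := i.pos; omega⟩).symm.trans (h2 ⟨1, by have := i.pos; omega⟩)
  simpa using mul_right_cancel₀ h0 h3

/-- Moving the i-th coordinate of an independent family keeps it independent near z₀, so its
cofactors remain a holomorphically varying normal of the hyperplane; their ratio is the root. -/
lemma IsProperHol.exists_local_root {n : ℕ} {F : (Fin n → ℂ) → (Fin n → ℂ)} (hF : IsProperHol F)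
    (i : Fin n) {z₀ : ℂ} (hz₀ : z₀ ∈ disc) :
    ∃ β : ℂ → ℂ, DifferentiableAt ℂ β z₀ ∧ ∀ᶠ z in 𝓝 z₀, ∀ μ ∈ polydisc n, μ i = z →
      (symPoly (F μ)).eval (β z) = 0 := by
  obtain ⟨y, hy, hli⟩ := hF.exists_independent i hz₀
  set r : ℂ → Fin n → Fin (n + 1) → ℂ := fun z k => coeffVec (F (Function.update (y k) i z)) with hr
  have hr₀ : r z₀ = fun k => coeffVec (F (y k)) := by
    ext1 k
    rw [hr]
    simp only [← (hy k).2, Function.update_eq_self]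
  have hrd : DifferentiableAt ℂ r z₀ := by
    refine DifferentiableOn.differentiableAt (s := disc) ?_ (isOpen_disc.mem_nhds hz₀)
    refine differentiableOn_pi.2 fun k => ?_
    exact (differentiable_coeffVec n).comp_differentiableOn (hF.diff.comp
      (differentiable_update _ _).differentiableOn fun z hz => update_mem_polydisc (hy k).1 i hz)
  have hcd : ∀ l, DifferentiableAt ℂ (fun z => cofactors (r z) l) z₀ := fun l =>
    (differentiable_cofactors l _).comp z₀ hrd
  -- Rows with a common root e have cofactors proportional to the powers of e, so the Veronese
  -- relations hold at the boundary and hence inside.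
  have hrel : ∀ z ∈ disc, ∀ a b c d : Fin (n + 1), (a : ℕ) + b = c + d →
      cofactors (r z) a * cofactors (r z) b = cofactors (r z) c * cofactors (r z) d := by
    intro z hz a b c d habcd
    have := hF.relation_eq_zero (V := Set.univ) (y := y) (q := fun r : Fin n → Fin (n + 1) → ℂ =>
      cofactors r a * cofactors r b - cofactors r c * cofactors r d)
      (((differentiable_cofactors a).mul (differentiable_cofactors b)).sub
        ((differentiable_cofactors c).mul (differentiable_cofactors d))) isClosed_univ i
      (fun k => (hy k).1) (fun _ _ _ => Set.mem_univ _) (fun r _ e _ her => ?_) hz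
    · exact sub_eq_zero.1 this
    · simp only [cofactors_eq_pow_mul her a, cofactors_eq_pow_mul her b,
        cofactors_eq_pow_mul her c, cofactors_eq_pow_mul her d]
      have : e ^ (a : ℕ) * e ^ (b : ℕ) = e ^ (c : ℕ) * e ^ (d : ℕ) := by
        rw [← pow_add, ← pow_add, habcd]
      linear_combination this * (cofactors r 0) ^ 2
  have hlast : ∀ z, r z i (Fin.last n) = 1 := fun z => coeffVec_last _
  have h0 := (cofactors_geometric (r := r z₀) (hr₀ ▸ hli) i (hlast _) (hrel z₀ hz₀)).1
  let o : Fin (n + 1) := ⟨1, by have := i.pos; omega⟩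
  refine ⟨fun z => cofactors (r z) o / cofactors (r z) 0, (hcd o).fun_div (hcd 0) h0, ?_⟩
  filter_upwards [(hcd 0).continuousAt.eventually_ne h0, isOpen_disc.mem_nhds hz₀]
    with z hz hzd μ hμ hμi
  have hliz : LinearIndependent ℂ (r z) :=
    (cofactors_ne_zero_iff _).1 fun h => hz (by rw [h, Pi.zero_apply])
  obtain ⟨-, o', ho', hgeom⟩ := cofactors_geometric hliz i (hlast z) (hrel z hzd)
  obtain rfl : o' = o := Fin.ext ho'
  have hmem := hF.mem_span_of_independent (i := i) (z := z)
    (fun k => ⟨update_mem_polydisc (hy k).1 i hzd, Function.update_self _ _ _⟩) hliz hμ hμi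
  have hs := sum_mul_cofactors_eq_zero hmem
  change ∑ l, coeffVec (F μ) l * cofactors (r z) l = 0 at hs
  rw [symPoly_eval]
  apply mul_left_cancel₀ hz
  rw [mul_zero, Finset.mul_sum, ← hs]
  refine Finset.sum_congr rfl fun l _ => ?_
  rw [hgeom l]
  ring

/-- The values of a proper holomorphic map have a root that depends, holomorphically, on one
variable only. -/
lemma IsProperHol.exists_root {n : ℕ} {F : (Fin n → ℂ) → (Fin n → ℂ)} (hF : IsProperHol F)
    (i : Fin n) : ∃ b : ℂ → ℂ, DifferentiableOn ℂ b disc ∧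
      ∀ μ ∈ polydisc n, (symPoly (F μ)).eval (b (μ i)) = 0 := by
  have hex : ∀ z, ∃ b : ℂ, z ∈ disc → ∀ μ ∈ polydisc n, μ i = z →
      (symPoly (F μ)).eval b = 0 := by
    intro z
    by_cases hz : z ∈ disc
    · obtain ⟨β, -, hβ⟩ := hF.exists_local_root i hz
      exact ⟨β z, fun _ => hβ.self_of_nhds⟩
    · exact ⟨0, fun h => absurd h hz⟩
  choose b hb using hex
  refine ⟨b, fun z₀ hz₀ => ?_, fun μ hμ => hb _ (hμ i) μ hμ rfl⟩
  obtain ⟨β, hβd, hβ⟩ := hF.exists_local_root i hz₀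
  refine (hβd.congr_of_eventuallyEq ?_).differentiableWithinAt
  filter_upwards [hβ, isOpen_disc.mem_nhds hz₀] with z hz hzd
  exact hF.common_root_unique i hzd (hb z hzd) hz

/-- The root function is not constant. -/
lemma IsProperHol.not_common_root {n : ℕ} {F : (Fin n → ℂ) → (Fin n → ℂ)} (hF : IsProperHol F)
    (β : ℂ) : ¬ ∀ μ ∈ polydisc n, (symPoly (F μ)).eval β = 0 := by
  intro h
  have hker : sliceSpan F Finset.univ 0 ≤ LinearMap.ker (evalCoeff n β) := by
    rw [sliceSpan, Submodule.span_le]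
    rintro _ ⟨μ, hμ, rfl⟩
    rw [SetLike.mem_coe, LinearMap.mem_ker, ← eval_symPoly_eq]
    exact h μ hμ.1
  rw [hF.sliceSpan_univ (zero_mem_polydisc n)] at hker
  have := hker (Submodule.mem_top (x := Pi.single 0 1))
  simp [LinearMap.mem_ker, evalCoeff_apply, Pi.single_apply] at this

/-- Distinct elements can be chosen from finitely many infinite sets. -/
lemma exists_injective_forall_mem {α : Type*} {n : ℕ} {S : Fin n → Set α}
    (hS : ∀ j, (S j).Infinite) : ∃ g : Fin n → α, Function.Injective g ∧ ∀ j, g j ∈ S j := by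
  classical
  choose T hT hTc using fun j => (hS j).exists_subset_card_eq n
  obtain ⟨g, hg, hgT⟩ := (Finset.all_card_le_biUnion_card_iff_exists_injective T).1 (fun s => by
    rcases s.eq_empty_or_nonempty with rfl | ⟨j, hj⟩
    · simp
    · calc s.card ≤ n := by simpa using s.card_le_univ
        _ = (T j).card := (hTc j).symm
        _ ≤ _ := Finset.card_le_card (Finset.subset_biUnion_of_mem T hj))
  exact ⟨g, hg, fun j => hT j (hgT j)⟩

lemma infinite_image_of_nonconst {b : ℂ → ℂ} (hb : DifferentiableOn ℂ b disc)
    (hconst : ¬ ∃ β, ∀ z ∈ disc, b z = β) {z₀ : ℂ} (hz₀ : z₀ ∈ disc) {U : Set ℂ} (hU : U ∈ 𝓝 z₀) :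
    (b '' (U ∩ disc)).Infinite := by
  have han : AnalyticOnNhd ℂ b disc := hb.analyticOnNhd isOpen_disc
  rcases (han z₀ hz₀).eventually_constant_or_nhds_le_map_nhds with h | h
  · exact absurd ⟨b z₀, fun z hz => han.eqOn_of_preconnected_of_eventuallyEq
      analyticOnNhd_const (convex_ball 0 1).isPreconnected hz₀ h hz⟩ hconst
  · refine infinite_of_mem_nhds (b z₀) (h ?_)
    exact Filter.image_mem_map (inter_mem hU (isOpen_disc.mem_nhds hz₀))

/-- A symmetric proper holomorphic map is induced by a function of one variable. -/
lemma IsProperHol.exists_eq_symMap {n : ℕ} (hn : 1 ≤ n) {F : (Fin n → ℂ) → (Fin n → ℂ)}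
    (hF : IsProperHol F) (hsymm : ∀ μ, ∀ σ : Equiv.Perm (Fin n), F (μ ∘ σ) = F μ) :
    ∃ b : ℂ → ℂ, DifferentiableOn ℂ b disc ∧ Set.MapsTo b disc disc ∧
      (¬ ∃ β, ∀ z ∈ disc, b z = β) ∧
      ∀ μ ∈ polydisc n, F μ = symMap n (fun j => b (μ j)) := by
  let i₀ : Fin n := ⟨0, hn⟩
  obtain ⟨b, hbd, hb⟩ := hF.exists_root i₀
  have hconst : ¬ ∃ β, ∀ z ∈ disc, b z = β := by
    rintro ⟨β, hβ⟩
    refine hF.not_common_root β fun μ hμ => ?_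
    rw [← hβ (μ i₀) (hμ i₀)]
    exact hb μ hμ
  have hball : ∀ μ ∈ polydisc n, ∀ j, (symPoly (F μ)).eval (b (μ j)) = 0 := by
    intro μ hμ j
    have := hb (μ ∘ Equiv.swap i₀ j) (fun k => hμ _)
    rwa [hsymm, Function.comp_apply, Equiv.swap_apply_left] at this
  refine ⟨b, hbd, fun z hz => ?_, hconst, fun μ hμ => ?_⟩
  · rw [mem_disc]
    by_contra hcon
    have hm : (fun _ => z : Fin n → ℂ) ∈ polydisc n := fun _ => hz
    exact symPoly_eval_ne_zero (hF.maps hm) (not_lt.1 hcon) (hball _ hm i₀)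
  · have hcont1 : ContinuousAt F μ :=
      (hF.diff.differentiableAt ((isOpen_polydisc n).mem_nhds hμ)).continuousAt
    have hcont2 : ContinuousAt (fun μ : Fin n → ℂ => symMap n (fun j => b (μ j))) μ := by
      refine (differentiable_symMap n).continuous.continuousAt.comp (continuousAt_pi.2 fun j => ?_)
      exact ContinuousAt.comp (g := b)
        (hbd.differentiableAt (isOpen_disc.mem_nhds (hμ j))).continuousAt
        (continuous_apply j).continuousAt
    -- The b(μⱼ) may coincide. By the open mapping theorem, arbitrarily close ν have distinct b(νⱼ),
    -- and these determine F ν.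
    have hcl : μ ∈ closure {ν | F ν = symMap n (fun j => b (ν j))} := by
      rw [Metric.mem_closure_iff]
      intro ε hε
      obtain ⟨g, hg, hgm⟩ := exists_injective_forall_mem fun j =>
        infinite_image_of_nonconst hbd hconst (hμ j) (Metric.ball_mem_nhds (μ j) hε)
      choose ν hν hνg using hgm
      refine ⟨ν, ?_, ?_⟩
      · have hνp : ν ∈ polydisc n := fun j => (hν j).2
        refine eq_symMap_of_roots ?_ ?_ (hball ν hνp)
        · obtain ⟨z, -, hz⟩ := hF.maps hνp
          exact ⟨z, hz⟩
        · simpa only [hνg] using hg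
      · rw [dist_comm, dist_pi_lt_iff hε]
        exact fun j => (hν j).1
    obtain ⟨u, hu, hulim⟩ := mem_closure_iff_seq_limit.1 hcl
    refine tendsto_nhds_unique (hcont1.tendsto.comp hulim)
      ((hcont2.tendsto.comp hulim).congr fun k => (hu k).symm)

end SymPolydisc
-- Finite Blaschke products.
namespace SymPolydisc
open Filter Topology

/-- The filter of points of the unit disc tending to the unit circle. -/
noncomputable def toCircle : Filter ℂ := comap (fun z : ℂ => ‖z‖) (𝓝[<] 1)

lemma tendsto_toCircle_iff {α : Type*} {l : Filter α} {z : α → ℂ} :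
    Tendsto z l toCircle ↔ Tendsto (fun a => ‖z a‖) l (𝓝 1) ∧ ∀ᶠ a in l, z a ∈ disc := by
  rw [toCircle, tendsto_comap_iff, tendsto_nhdsWithin_iff]
  simp only [mem_disc]
  rfl

lemma disc_mem_toCircle : disc ∈ toCircle :=
  (tendsto_toCircle_iff.1 (tendsto_id (x := toCircle))).2

lemma tendsto_norm_toCircle : Tendsto (fun z : ℂ => ‖z‖) toCircle (𝓝 1) :=
  (tendsto_toCircle_iff.1 (tendsto_id (x := toCircle))).1

/-- The factor of a Blaschke product with zero `a`. -/
noncomputable def blaschkeFactor (a z : ℂ) : ℂ := (z - a) / (1 - starRingEnd ℂ a * z)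

lemma one_sub_conj_mul_ne_zero {a z : ℂ} (ha : a ∈ disc) (hz : z ∈ disc) :
    1 - starRingEnd ℂ a * z ≠ 0 := by
  intro h
  have h1 : ‖starRingEnd ℂ a * z‖ = 1 := by rw [← sub_eq_zero.1 h, norm_one]
  rw [norm_mul, RCLike.norm_conj] at h1
  rw [mem_disc] at ha hz
  nlinarith [norm_nonneg a, norm_nonneg z]

lemma differentiableOn_blaschkeFactor {a : ℂ} (ha : a ∈ disc) :
    DifferentiableOn ℂ (blaschkeFactor a) disc := by
  refine DifferentiableOn.div (by fun_prop) (by fun_prop) fun z hz => one_sub_conj_mul_ne_zero ha hz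

lemma one_sub_norm_blaschkeFactor_sq {a z : ℂ} (ha : a ∈ disc) (hz : z ∈ disc) :
    1 - ‖blaschkeFactor a z‖ ^ 2 =
      (1 - ‖a‖ ^ 2) * (1 - ‖z‖ ^ 2) / ‖1 - starRingEnd ℂ a * z‖ ^ 2 := by
  have h := one_sub_conj_mul_ne_zero ha hz
  have h' : ‖1 - starRingEnd ℂ a * z‖ ^ 2 ≠ 0 := pow_ne_zero _ (norm_ne_zero_iff.2 h)
  rw [blaschkeFactor, norm_div, div_pow, eq_div_iff h', sub_mul, div_mul_cancel₀ _ h']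
  simp only [← Complex.normSq_eq_norm_sq, Complex.normSq_apply, Complex.sub_re, Complex.sub_im,
    Complex.mul_re, Complex.mul_im, Complex.conj_re, Complex.conj_im, Complex.one_re,
    Complex.one_im]
  ring

lemma blaschkeFactor_mem_disc {a z : ℂ} (ha : a ∈ disc) (hz : z ∈ disc) :
    blaschkeFactor a z ∈ disc := by
  have h := one_sub_norm_blaschkeFactor_sq ha hz
  have h' : 0 < ‖1 - starRingEnd ℂ a * z‖ := norm_pos_iff.2 (one_sub_conj_mul_ne_zero ha hz)
  rw [mem_disc] at *
  have h1 : 0 < 1 - ‖a‖ ^ 2 := by nlinarith [norm_nonneg a]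
  have h2 : 0 < 1 - ‖z‖ ^ 2 := by nlinarith [norm_nonneg z]
  have h3 : 0 < 1 - ‖blaschkeFactor a z‖ ^ 2 := by
    rw [h]
    positivity
  nlinarith [norm_nonneg (blaschkeFactor a z)]

/-- At fixed z this is bounded away from 1 uniformly for a in a smaller disc, which limits how many
zeros can be divided out. The 4 comes from |1 - āz| ≤ 2. -/
lemma norm_blaschkeFactor_sq_le {a z : ℂ} (ha : a ∈ disc) (hz : z ∈ disc) :
    ‖blaschkeFactor a z‖ ^ 2 ≤ 1 - (1 - ‖a‖ ^ 2) * (1 - ‖z‖ ^ 2) / 4 := by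
  have h := one_sub_norm_blaschkeFactor_sq ha hz
  have h' : 0 < ‖1 - starRingEnd ℂ a * z‖ := norm_pos_iff.2 (one_sub_conj_mul_ne_zero ha hz)
  rw [mem_disc] at ha hz
  have h1 : 0 < 1 - ‖a‖ ^ 2 := by nlinarith [norm_nonneg a]
  have h2 : 0 < 1 - ‖z‖ ^ 2 := by nlinarith [norm_nonneg z]
  have h3 : ‖1 - starRingEnd ℂ a * z‖ ≤ 2 := by
    have := norm_sub_le 1 (starRingEnd ℂ a * z)
    rw [norm_mul, RCLike.norm_conj, norm_one] at this
    nlinarith [norm_nonneg a, norm_nonneg z]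
  have h4 : (1 - ‖a‖ ^ 2) * (1 - ‖z‖ ^ 2) / 4 ≤
      (1 - ‖a‖ ^ 2) * (1 - ‖z‖ ^ 2) / ‖1 - starRingEnd ℂ a * z‖ ^ 2 := by
    gcongr
    nlinarith
  linarith

lemma tendsto_norm_blaschkeFactor {a : ℂ} (ha : a ∈ disc) :
    Tendsto (fun z => ‖blaschkeFactor a z‖) toCircle (𝓝 1) := by
  have ha' := mem_disc.1 ha
  have h1 : Tendsto (fun z : ℂ => (1 - ‖a‖ ^ 2) * (1 - ‖z‖ ^ 2) / (1 - ‖a‖) ^ 2) toCircle (𝓝 0) := by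
    have := (((tendsto_norm_toCircle.pow 2).const_sub 1).const_mul (1 - ‖a‖ ^ 2)).div_const
      ((1 - ‖a‖) ^ 2)
    simpa using this
  have h2 : Tendsto (fun z => 1 - ‖blaschkeFactor a z‖ ^ 2) toCircle (𝓝 0) := by
    refine tendsto_of_tendsto_of_tendsto_of_le_of_le' tendsto_const_nhds h1 ?_ ?_
    · filter_upwards [disc_mem_toCircle] with z hz
      have := mem_disc.1 (blaschkeFactor_mem_disc ha hz)
      nlinarith [norm_nonneg (blaschkeFactor a z)]
    · filter_upwards [disc_mem_toCircle] with z hz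
      rw [one_sub_norm_blaschkeFactor_sq ha hz]
      rw [mem_disc] at hz
      have h1 : 0 < 1 - ‖a‖ ^ 2 := by nlinarith [norm_nonneg a]
      have h2 : 0 < 1 - ‖z‖ ^ 2 := by nlinarith [norm_nonneg z]
      have h3 : 0 < 1 - ‖a‖ := by linarith
      gcongr
      have := norm_sub_norm_le 1 (starRingEnd ℂ a * z)
      rw [norm_mul, RCLike.norm_conj, norm_one] at this
      nlinarith [norm_nonneg a, norm_nonneg z]
  have h3 := (h2.const_sub 1).sqrt
  simpa [Real.sqrt_sq (norm_nonneg _)] using h3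

lemma exists_eq_blaschkeFactor_mul {h : ℂ → ℂ} (hh : DifferentiableOn ℂ h disc) {a : ℂ}
    (ha : a ∈ disc) (h0 : h a = 0) : ∃ g : ℂ → ℂ, DifferentiableOn ℂ g disc ∧
      ∀ z ∈ disc, h z = blaschkeFactor a z * g z := by
  refine ⟨fun z => (1 - starRingEnd ℂ a * z) * dslope h a z, ?_, fun z hz => ?_⟩
  · refine DifferentiableOn.fun_mul (by fun_prop) ?_
    rwa [Complex.differentiableOn_dslope (isOpen_disc.mem_nhds ha)]
  · have h1 := sub_smul_dslope h a z
    rw [h0, sub_zero, smul_eq_mul] at h1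
    rw [blaschkeFactor, ← mul_assoc, div_mul_cancel₀ _ (one_sub_conj_mul_ne_zero ha hz), h1]

lemma norm_le_one_of_tendsto_toCircle {g : ℂ → ℂ} (hg : DifferentiableOn ℂ g disc)
    (hlim : Tendsto (fun z => ‖g z‖) toCircle (𝓝 1)) {z : ℂ} (hz : z ∈ disc) : ‖g z‖ ≤ 1 := by
  obtain ⟨s, hs, hs1, hle⟩ := exists_seq_norm_le hg hz
  exact ge_of_tendsto' (hlim.comp (tendsto_toCircle_iff.2 ⟨hs1, Eventually.of_forall hs⟩)) hle

/-- The maximum principle for g and 1/g makes the modulus constantly 1. -/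
lemma eq_const_of_tendsto_toCircle {g : ℂ → ℂ} (hg : DifferentiableOn ℂ g disc)
    (hlim : Tendsto (fun z => ‖g z‖) toCircle (𝓝 1)) (h0 : ∀ z ∈ disc, g z ≠ 0) :
    ‖g 0‖ = 1 ∧ ∀ z ∈ disc, g z = g 0 := by
  have hle : ∀ z ∈ disc, ‖g z‖ = 1 := fun z hz => by
    refine le_antisymm (norm_le_one_of_tendsto_toCircle hg hlim hz) ?_
    have h1 : Tendsto (fun z => ‖(g z)⁻¹‖) toCircle (𝓝 1) := by
      simpa using hlim.inv₀ one_ne_zero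
    have h2 := norm_le_one_of_tendsto_toCircle (hg.fun_inv h0) h1 hz
    rw [norm_inv] at h2
    exact (inv_le_one₀ (norm_pos_iff.2 (h0 z hz))).1 h2
  have h00 : (0 : ℂ) ∈ disc := by simp [mem_disc]
  refine ⟨hle 0 h00, fun z hz => ?_⟩
  exact Complex.eqOn_of_isPreconnected_of_isMaxOn_norm (convex_ball 0 1).isPreconnected isOpen_disc
    hg h00 (fun y hy => by simp [hle y hy, hle 0 h00]) hz

lemma tendsto_norm_prod_blaschkeFactor {m : ℕ} {a : Fin m → ℂ} (ha : ∀ j, a j ∈ disc) :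
    Tendsto (fun z => ‖∏ j, blaschkeFactor (a j) z‖) toCircle (𝓝 1) := by
  simp_rw [norm_prod]
  have := tendsto_finsetProd (Finset.univ : Finset (Fin m))
    (fun j _ => tendsto_norm_blaschkeFactor (ha j))
  simpa using this

/-- A holomorphic function on the disc whose modulus tends to `1` at the unit circle is a finite
Blaschke product. -/
lemma isFiniteBlaschke_of_tendsto {h : ℂ → ℂ} (hh : DifferentiableOn ℂ h disc)
    (hlim : Tendsto (fun z => ‖h z‖) toCircle (𝓝 1)) (hconst : ¬ ∃ β, ∀ z ∈ disc, h z = β) :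
    IsFiniteBlaschke h := by
  let P : ℕ → Prop := fun m => ∃ a : Fin m → ℂ, (∀ j, a j ∈ disc) ∧ ∃ g : ℂ → ℂ,
    DifferentiableOn ℂ g disc ∧ ∀ z ∈ disc, h z = (∏ j, blaschkeFactor (a j) z) * g z
  have hglim : ∀ {m : ℕ} {a : Fin m → ℂ}, (∀ j, a j ∈ disc) → ∀ {g : ℂ → ℂ},
      (∀ z ∈ disc, h z = (∏ j, blaschkeFactor (a j) z) * g z) →
      Tendsto (fun z => ‖g z‖) toCircle (𝓝 1) := by
    intro m a ha g hg
    have h1 := tendsto_norm_prod_blaschkeFactor ha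
    have h2 := hlim.div h1 one_ne_zero
    rw [div_one] at h2
    refine h2.congr' ?_
    filter_upwards [disc_mem_toCircle, h1.eventually_ne one_ne_zero] with z hz hne
    rw [Pi.div_apply, hg z hz, norm_mul, mul_div_cancel_left₀ _ hne]
  obtain ⟨w, hw, hw0⟩ : ∃ w ∈ disc, h w ≠ 0 := by
    by_contra! hcon
    exact hconst ⟨0, hcon⟩
  -- Zeros stay away from the circle because the modulus tends to 1 there.
  obtain ⟨ρ, hρ0, hρ1, hρ⟩ : ∃ ρ : ℝ, 0 ≤ ρ ∧ ρ < 1 ∧ ∀ a ∈ disc, h a = 0 → ‖a‖ ≤ ρ := by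
    have h1 := hlim.eventually_ne one_ne_zero
    rw [toCircle, eventually_comap, eventually_nhdsWithin_iff, Metric.eventually_nhds_iff] at h1
    obtain ⟨ε, hε, h2⟩ := h1
    refine ⟨max 0 (1 - ε), le_max_left _ _, max_lt one_pos (by linarith), fun a ha ha0 => ?_⟩
    by_contra! hcon
    rw [mem_disc] at ha
    have h3 := (le_max_right 0 (1 - ε)).trans_lt hcon
    refine h2 (y := ‖a‖) ?_ ha a rfl (by rw [ha0, norm_zero])
    rw [Real.dist_eq, abs_lt]
    constructor <;> linarith
  have hw1 := mem_disc.1 hw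
  set Q := 1 - (1 - ρ ^ 2) * (1 - ‖w‖ ^ 2) / 4 with hQ
  have hw2 : 0 < 1 - ‖w‖ ^ 2 := by nlinarith [norm_nonneg w]
  have hρ2 : 0 < 1 - ρ ^ 2 := by nlinarith
  have hQ1 : Q < 1 := by
    have : 0 < (1 - ρ ^ 2) * (1 - ‖w‖ ^ 2) := mul_pos hρ2 hw2
    linarith
  have hQ0 : 0 ≤ Q := by
    have : (1 - ρ ^ 2) * (1 - ‖w‖ ^ 2) ≤ 1 :=
      mul_le_one₀ (by nlinarith) hw2.le (by nlinarith [norm_nonneg w])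
    linarith
  have hbound : ∀ m, P m → ‖h w‖ ^ 2 ≤ Q ^ m := by
    rintro m ⟨a, ha, g, hg, hhg⟩
    have h1 := norm_le_one_of_tendsto_toCircle hg (hglim ha hhg) hw
    rw [hhg w hw, norm_mul, mul_pow, norm_prod, ← Finset.prod_pow]
    calc (∏ j, ‖blaschkeFactor (a j) w‖ ^ 2) * ‖g w‖ ^ 2 ≤ (∏ _j : Fin m, Q) * 1 := by
          gcongr with j
          · refine (norm_blaschkeFactor_sq_le (ha j) hw).trans ?_
            have h2 : ‖a j‖ ≤ ρ := by
              refine hρ _ (ha j) ?_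
              rw [hhg _ (ha j), Finset.prod_eq_zero (Finset.mem_univ j), zero_mul]
              simp [blaschkeFactor]
            have h3 : ‖a j‖ ^ 2 ≤ ρ ^ 2 := by gcongr
            rw [hQ]
            nlinarith
          · exact pow_le_one₀ (norm_nonneg _) h1
      _ = Q ^ m := by simp
  -- Dividing out zeros must stop, since Qᵐ eventually drops below ‖h w‖²; the remaining quotient is
  -- then zero-free.
  obtain ⟨m, ⟨a, ha, g, hg, hhg⟩, hm⟩ : ∃ m, P m ∧ ¬ P (m + 1) := by
    by_contra! hcon
    have hall : ∀ m, P m := fun m => by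
      induction m with
      | zero => exact ⟨Fin.elim0, fun j => j.elim0, h, hh, fun z _ => by simp⟩
      | succ m ih => exact hcon m ih
    obtain ⟨m, hm⟩ := exists_pow_lt_of_lt_one (by positivity : 0 < ‖h w‖ ^ 2) hQ1
    exact absurd (hbound m (hall m)) (not_le.2 hm)
  have hg0 : ∀ z ∈ disc, g z ≠ 0 := by
    intro z hz h0
    obtain ⟨g', hg', hgg'⟩ := exists_eq_blaschkeFactor_mul hg hz h0
    refine hm ⟨Fin.cons z a, fun j => ?_, g', hg', fun y hy => ?_⟩
    · exact Fin.cases hz ha j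
    · rw [hhg y hy, hgg' y hy, Fin.prod_univ_succ]
      simp only [Fin.cons_zero, Fin.cons_succ]
      ring
  obtain ⟨hc, hconst'⟩ := eq_const_of_tendsto_toCircle hg (hglim ha hhg) hg0
  refine ⟨m, g 0, a, ?_, hc, ha, fun z hz => ?_⟩
  · rw [Nat.one_le_iff_ne_zero]
    rintro rfl
    exact hconst ⟨g 0, fun z hz => by rw [hhg z hz, hconst' z hz]; simp⟩
  · rw [hhg z hz, hconst' z hz, mul_comm]
    rfl

lemma IsFiniteBlaschke.differentiableOn {B : ℂ → ℂ} (hB : IsFiniteBlaschke B) :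
    DifferentiableOn ℂ B disc := by
  obtain ⟨m, c, a, hm, hc, ha, hBz⟩ := hB
  have h1 : DifferentiableOn ℂ (fun z => c * ∏ j, blaschkeFactor (a j) z) disc :=
    (DifferentiableOn.fun_finsetProd fun j _ => differentiableOn_blaschkeFactor (ha j)).const_mul c
  exact h1.congr hBz

lemma IsFiniteBlaschke.tendsto_norm {B : ℂ → ℂ} (hB : IsFiniteBlaschke B) :
    Tendsto (fun z => ‖B z‖) toCircle (𝓝 1) := by
  obtain ⟨m, c, a, hm, hc, ha, hBz⟩ := hB
  refine (tendsto_norm_prod_blaschkeFactor ha).congr' ?_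
  filter_upwards [disc_mem_toCircle] with z hz
  rw [hBz z hz, norm_mul, hc, one_mul]
  rfl

lemma IsFiniteBlaschke.mapsTo {B : ℂ → ℂ} (hB : IsFiniteBlaschke B) : Set.MapsTo B disc disc := by
  obtain ⟨m, c, a, hm, hc, ha, hBz⟩ := hB
  intro z hz
  rw [mem_disc, hBz z hz, norm_mul, hc, one_mul, norm_prod]
  obtain ⟨m, rfl⟩ := Nat.exists_eq_succ_of_ne_zero (Nat.one_le_iff_ne_zero.1 hm)
  rw [Fin.prod_univ_succ]
  have h1 := mem_disc.1 (blaschkeFactor_mem_disc (ha 0) hz)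
  refine mul_lt_one_of_nonneg_of_lt_one_left (norm_nonneg _) h1 ?_
  exact Finset.prod_le_one (fun _ _ => norm_nonneg _)
    fun j _ => (mem_disc.1 (blaschkeFactor_mem_disc (ha j.succ) hz)).le

end SymPolydisc
-- Properness of the symmetrization map and the Blaschke characterization.
namespace SymPolydisc
open Filter Topology Polynomial

/-- Symmetrization is itself proper: a limit in the closed polydisc whose image lies in the
symmetrized polydisc has all coordinates in the open disc, these being the roots. -/
lemma properOn_of_isProperMap {n : ℕ} {f : (Fin n → ℂ) → (Fin n → ℂ)}
    {hmaps : Set.MapsTo f (symPolydisc n) (symPolydisc n)}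
    (hf : IsProperMap (hmaps.restrict f (symPolydisc n) (symPolydisc n))) :
    ProperOn (fun z => f (symMap n z)) (polydisc n) (symPolydisc n) := by
  intro 𝒰 h𝒰 y hy hlim
  let p : polydisc n → symPolydisc n := fun z => ⟨symMap n z, z, z.2, rfl⟩
  have hr : Set.range ((↑) : polydisc n → Fin n → ℂ) ∈ 𝒰 := by
    rwa [Subtype.range_coe]
  set 𝒱 := 𝒰.comap Subtype.coe_injective hr with h𝒱
  have hmap : map ((↑) : polydisc n → Fin n → ℂ) 𝒱 = 𝒰 := by
    rw [h𝒱, Ultrafilter.coe_comap, map_comap_of_mem hr]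
  obtain ⟨x, -, hx⟩ := (isProperMap_iff_ultrafilter.1 hf).2 (𝒰 := 𝒱.map p) (y := ⟨y, hy⟩) (by
    rw [tendsto_subtype_rng, Ultrafilter.coe_map, tendsto_map'_iff]
    change Tendsto ((fun z => f (symMap n z)) ∘ ((↑) : polydisc n → Fin n → ℂ)) 𝒱 (𝓝 y)
    rwa [← tendsto_map'_iff, hmap])
  obtain ⟨μ, -, hμ⟩ := exists_ultrafilter_tendsto 𝒱 (μ := ((↑) : polydisc n → Fin n → ℂ))
    (fun a => a.2)
  have h1 : Tendsto (fun a : polydisc n => symMap n a) 𝒱 (𝓝 (x : Fin n → ℂ)) :=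
    (continuous_subtype_val.tendsto x).comp (show Tendsto p 𝒱 (𝓝 x) from hx)
  have h2 : Tendsto (fun a : polydisc n => symMap n a) 𝒱 (𝓝 (symMap n μ)) :=
    ((differentiable_symMap n).continuous.tendsto μ).comp hμ
  refine ⟨μ, mem_polydisc_of_symMap_mem ?_, ?_⟩
  · rw [← tendsto_nhds_unique h1 h2]
    exact x.2
  · rw [← hmap]
    exact hμ

lemma isProperHol_comp_symMap {n : ℕ} {f : (Fin n → ℂ) → (Fin n → ℂ)}
    {hmaps : Set.MapsTo f (symPolydisc n) (symPolydisc n)} (hd : DifferentiableOn ℂ f (symPolydisc n))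
    (hf : IsProperMap (hmaps.restrict f (symPolydisc n) (symPolydisc n))) :
    IsProperHol (fun z => f (symMap n z)) where
  diff := hd.comp (differentiable_symMap n).differentiableOn fun z hz => ⟨z, hz, rfl⟩
  maps := fun z hz => hmaps ⟨z, hz, rfl⟩
  proper := properOn_of_isProperMap hf

lemma exists_ultrafilter_tendsto_disc {α : Type*} (𝒰 : Ultrafilter α) {b : α → ℂ}
    (hb : ∀ᶠ a in 𝒰, b a ∈ disc) : ∃ β : ℂ, ‖β‖ ≤ 1 ∧ Tendsto b 𝒰 (𝓝 β) := by
  obtain ⟨β, h1, h2⟩ := (isCompact_closedBall (0 : ℂ) 1).ultrafilter_le_nhds (𝒰.map b) (by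
    rw [le_principal_iff, Ultrafilter.coe_map, mem_map]
    exact hb.mono fun a ha => Metric.ball_subset_closedBall ha)
  exact ⟨β, by simpa using h1, h2⟩

lemma tendsto_norm_toCircle_of_properOn {b : ℂ → ℂ} (hmaps : Set.MapsTo b disc disc)
    (hb : ProperOn b disc disc) : Tendsto (fun z => ‖b z‖) toCircle (𝓝 1) := by
  rw [tendsto_iff_ultrafilter]
  intro 𝒰 h𝒰
  have hd : disc ∈ (𝒰 : Filter ℂ) := h𝒰 disc_mem_toCircle
  obtain ⟨β, hβ, hlim⟩ := exists_ultrafilter_tendsto_disc 𝒰 (mem_of_superset hd hmaps)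
  rcases hβ.lt_or_eq with h | h
  · obtain ⟨x, hx, hxlim⟩ := hb 𝒰 hd β (mem_disc.2 h) hlim
    have h1 : Tendsto (fun z : ℂ => ‖z‖) 𝒰 (𝓝 ‖x‖) := (continuous_norm.tendsto x).mono_left hxlim
    have h2 := tendsto_nhds_unique h1 (tendsto_norm_toCircle.mono_left h𝒰)
    exact absurd h2 (mem_disc.1 hx).ne
  · rw [← h]
    exact hlim.norm

lemma ProperOn.of_symMap {n : ℕ} (hn : 1 ≤ n) {F : (Fin n → ℂ) → (Fin n → ℂ)}
    (hF : ProperOn F (polydisc n) (symPolydisc n)) {b : ℂ → ℂ}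
    (hb : ∀ μ ∈ polydisc n, F μ = symMap n (fun j => b (μ j))) : ProperOn b disc disc := by
  intro 𝒰 h𝒰 β hβ hlim
  have hpoly : ∀ z ∈ disc, (fun _ => z : Fin n → ℂ) ∈ polydisc n := fun z hz _ => hz
  obtain ⟨x, hx, hxlim⟩ := hF (𝒰.map fun z _ => z)
    (Ultrafilter.mem_map.2 (mem_of_superset h𝒰 hpoly)) (symMap n fun _ => β)
    ⟨_, hpoly β hβ, rfl⟩ (by
      rw [Ultrafilter.coe_map, tendsto_map'_iff]
      have h1 : Tendsto (fun z => symMap n (fun _ => b z)) 𝒰 (𝓝 (symMap n fun _ => β)) :=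
        ((differentiable_symMap n).continuous.tendsto _).comp (tendsto_pi_nhds.2 fun _ => hlim)
      refine h1.congr' ?_
      filter_upwards [h𝒰] with z hz
      exact (hb _ (hpoly z hz)).symm)
  exact ⟨x ⟨0, hn⟩, hx _, tendsto_pi_nhds.1 (show Tendsto (fun z (_ : Fin n) => z) 𝒰 (𝓝 x) from hxlim)
    ⟨0, hn⟩⟩

lemma exists_blaschke_of_isProperMap {n : ℕ} (hn : 1 ≤ n) {f : (Fin n → ℂ) → (Fin n → ℂ)}
    {hmaps : Set.MapsTo f (symPolydisc n) (symPolydisc n)} (hd : DifferentiableOn ℂ f (symPolydisc n))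
    (hf : IsProperMap (hmaps.restrict f (symPolydisc n) (symPolydisc n))) :
    ∃ B : ℂ → ℂ, IsFiniteBlaschke B ∧
      ∀ z ∈ polydisc n, f (symMap n z) = symMap n (fun j => B (z j)) := by
  have hF := isProperHol_comp_symMap hd hf
  obtain ⟨b, hbd, hbm, hconst, hb⟩ := hF.exists_eq_symMap hn
    (fun μ σ => by simp only [symMap_comp_perm])
  exact ⟨b, isFiniteBlaschke_of_tendsto hbd
    (tendsto_norm_toCircle_of_properOn hbm (ProperOn.of_symMap hn hF.proper hb)) hconst, hb⟩

/-- Lift points to root tuples and pass to limits. A root tending to the circle would have B-value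
tending to the circle, contradicting that the limit of the values lies in the open set of tuples. -/
lemma isProperMap_of_blaschke {n : ℕ} {f : (Fin n → ℂ) → (Fin n → ℂ)}
    (hmaps : Set.MapsTo f (symPolydisc n) (symPolydisc n)) (hd : DifferentiableOn ℂ f (symPolydisc n))
    {B : ℂ → ℂ} (hB : IsFiniteBlaschke B)
    (hf : ∀ z ∈ polydisc n, f (symMap n z) = symMap n (fun j => B (z j))) :
    IsProperMap (hmaps.restrict f (symPolydisc n) (symPolydisc n)) := by
  have hcont : Continuous (hmaps.restrict f (symPolydisc n) (symPolydisc n)) :=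
    hd.continuousOn.mapsToRestrict hmaps
  rw [isProperMap_iff_ultrafilter]
  refine ⟨hcont, fun 𝒰 y hy => ?_⟩
  choose s hs hsu using fun u : symPolydisc n => u.2
  obtain ⟨μ, hμ1, hμ⟩ := exists_ultrafilter_tendsto 𝒰 hs
  obtain ⟨β, hβ1, hβ⟩ := exists_ultrafilter_tendsto 𝒰 (μ := fun u j => B (s u j))
    (fun u j => hB.mapsTo (hs u j))
  have hyβ : symMap n β = y := by
    have h1 : Tendsto (fun u => symMap n (fun j => B (s u j))) 𝒰 (𝓝 (symMap n β)) :=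
      ((differentiable_symMap n).continuous.tendsto β).comp hβ
    have h2 : Tendsto (fun u : symPolydisc n => f u) 𝒰 (𝓝 (y : Fin n → ℂ)) :=
      (continuous_subtype_val.tendsto y).comp hy
    refine tendsto_nhds_unique h1 (h2.congr fun u => ?_)
    rw [← hf _ (hs u), hsu]
  have hβd : β ∈ polydisc n := mem_polydisc_of_symMap_mem (hyβ ▸ y.2)
  have hμd : μ ∈ polydisc n := by
    intro j
    rw [mem_disc]
    refine lt_of_le_of_ne (hμ1 j) fun hj => ?_
    have h1 : Tendsto (fun u => s u j) 𝒰 toCircle :=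
      tendsto_toCircle_iff.2 ⟨hj ▸ (tendsto_pi_nhds.1 hμ j).norm, Eventually.of_forall fun u => hs u j⟩
    have h2 := tendsto_nhds_unique (hB.tendsto_norm.comp h1) (tendsto_pi_nhds.1 hβ j).norm
    exact absurd h2.symm (mem_disc.1 (hβd j)).ne
  have hlim : (𝒰 : Filter (symPolydisc n)) ≤ 𝓝 ⟨symMap n μ, μ, hμd, rfl⟩ := by
    have h1 : Tendsto (fun u => symMap n (s u)) 𝒰 (𝓝 (symMap n μ)) :=
      ((differentiable_symMap n).continuous.tendsto μ).comp hμ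
    simp_rw [hsu] at h1
    exact tendsto_subtype_rng.2 h1
  exact ⟨_, tendsto_nhds_unique ((hcont.tendsto _).mono_left hlim) hy, hlim⟩

lemma IsHolAut.isProperMap {E : Type*} [NormedAddCommGroup E] [NormedSpace ℂ E] {D : Set E}
    {f : E → E} (hf : IsHolAut D f) (hmaps : Set.MapsTo f D D) :
    IsProperMap (hmaps.restrict f D D) := by
  obtain ⟨-, hfd, g, hg, hgd, hgf, hfg⟩ := hf
  let e : D ≃ₜ D :=
    { toFun := hmaps.restrict f D D
      invFun := hg.restrict g D D
      left_inv := fun x => Subtype.ext (hgf x x.2)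
      right_inv := fun x => Subtype.ext (hfg x x.2)
      continuous_toFun := hfd.continuousOn.mapsToRestrict hmaps
      continuous_invFun := hgd.continuousOn.mapsToRestrict hg }
  exact e.isProperMap

/-- On the diagonal the only root is z itself. -/
lemma comp_eq_self_of_symMap {n : ℕ} (hn : 1 ≤ n) {f g : (Fin n → ℂ) → (Fin n → ℂ)} {B C : ℂ → ℂ}
    (hB : Set.MapsTo B disc disc)
    (hf : ∀ z ∈ polydisc n, f (symMap n z) = symMap n (fun j => B (z j)))
    (hg : ∀ z ∈ polydisc n, g (symMap n z) = symMap n (fun j => C (z j)))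
    (hgf : ∀ w ∈ symPolydisc n, g (f w) = w) {z : ℂ} (hz : z ∈ disc) : C (B z) = z := by
  have hz' : (fun _ => z : Fin n → ℂ) ∈ polydisc n := fun _ => hz
  have h := hgf _ ⟨_, hz', rfl⟩
  rw [hf _ hz', hg _ (fun _ => hB hz)] at h
  obtain ⟨i, hi⟩ := exists_eq_of_symMap_eq h ⟨0, hn⟩
  exact hi

lemma exists_holAut_of_isHolAut {n : ℕ} (hn : 1 ≤ n) {f : (Fin n → ℂ) → (Fin n → ℂ)}
    (hf : IsHolAut (symPolydisc n) f) : ∃ h : ℂ → ℂ, IsHolAut disc h ∧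
      ∀ z ∈ polydisc n, f (symMap n z) = symMap n (fun j => h (z j)) := by
  obtain ⟨hfm, hfd, g, hgm, hgd, hgf, hfg⟩ := id hf
  have hg : IsHolAut (symPolydisc n) g := ⟨hgm, hgd, f, hfm, hfd, hfg, hgf⟩
  obtain ⟨B, hB, hBf⟩ := exists_blaschke_of_isProperMap hn hfd (hf.isProperMap hfm)
  obtain ⟨C, hC, hCg⟩ := exists_blaschke_of_isProperMap hn hgd (hg.isProperMap hgm)
  exact ⟨B, ⟨hB.mapsTo, hB.differentiableOn, C, hC.mapsTo, hC.differentiableOn,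
    fun z hz => comp_eq_self_of_symMap hn hB.mapsTo hBf hCg hgf hz,
    fun z hz => comp_eq_self_of_symMap hn hC.mapsTo hCg hBf hfg hz⟩, hBf⟩

/-! ### Möbius transformations and the automorphisms they induce. -/

lemma blaschkeFactor_neg_comp {a z : ℂ} (ha : a ∈ disc) (hz : z ∈ disc) :
    blaschkeFactor a (blaschkeFactor (-a) z) = z := by
  have hna : -a ∈ disc := by simpa [mem_disc] using ha
  have h1 : 1 + starRingEnd ℂ a * z ≠ 0 := by
    simpa using one_sub_conj_mul_ne_zero hna hz
  have h2 : 1 - starRingEnd ℂ a * a ≠ 0 := one_sub_conj_mul_ne_zero ha ha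
  have h3 : 1 - starRingEnd ℂ a * blaschkeFactor (-a) z =
      (1 - starRingEnd ℂ a * a) / (1 + starRingEnd ℂ a * z) := by
    simp only [blaschkeFactor, map_neg, neg_mul, sub_neg_eq_add]
    field_simp
    ring
  have h4 : blaschkeFactor (-a) z * (1 + starRingEnd ℂ a * z) = z + a := by
    simp only [blaschkeFactor, map_neg, neg_mul, sub_neg_eq_add]
    exact div_mul_cancel₀ _ h1
  rw [blaschkeFactor, h3, div_div_eq_mul_div, div_eq_iff h2]
  linear_combination h4

/-- Holomorphic automorphisms of the disc are Möbius transformations. -/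
lemma IsHolAut.exists_eq_blaschkeFactor {k : ℂ → ℂ} (hk : IsHolAut disc k) :
    ∃ c : ℂ, ∃ a ∈ disc, ∀ z ∈ disc, k z = c * blaschkeFactor a z := by
  obtain ⟨hkm, hkd, h, hhm, hhd, hhk, hkh⟩ := hk
  have hprop : ProperOn k disc disc := by
    intro 𝒰 h𝒰 y hy hlim
    refine ⟨h y, hhm hy, ?_⟩
    have h1 : Tendsto (fun z => h (k z)) 𝒰 (𝓝 (h y)) :=
      (hhd.differentiableAt (isOpen_disc.mem_nhds hy)).continuousAt.tendsto.comp hlim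
    refine Tendsto.congr' (f₁ := fun z => h (k z)) (f₂ := id) ?_ h1
    filter_upwards [h𝒰] with z hz
    exact hhk z hz
  have h00 : (0 : ℂ) ∈ disc := by simp [mem_disc]
  have h02 : (1 / 2 : ℂ) ∈ disc := by
    rw [mem_disc]
    norm_num
  obtain ⟨m, c, a, hm, hc, ha, hBz⟩ := isFiniteBlaschke_of_tendsto hkd
    (tendsto_norm_toCircle_of_properOn hkm hprop) (by
      rintro ⟨β, hβ⟩
      have h1 := hhk 0 h00
      have h2 := hhk _ h02
      rw [hβ _ h00] at h1
      rw [hβ _ h02, h1] at h2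
      norm_num at h2)
  have haj : ∀ j, a j = h 0 := fun j => by
    rw [← hhk _ (ha j), hBz _ (ha j), Finset.prod_eq_zero (Finset.mem_univ j), mul_zero]
    simp
  have hkpow : ∀ z ∈ disc, k z = c * blaschkeFactor (h 0) z ^ m := fun z hz => by
    rw [hBz z hz]
    simp [haj, blaschkeFactor, div_pow]
  have ha0 : h 0 ∈ disc := hhm h00
  have hna : -h 0 ∈ disc := by simpa [mem_disc] using ha0
  -- By injectivity all zeros equal h 0, so k is a constant times an m-th power. It takes equal
  -- values where the Blaschke factor is 1/2 and ω/2, so injectivity gives ω = 1 and m = 1.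
  set ω := Complex.exp (2 * Real.pi * Complex.I / m) with hω
  have hprim : IsPrimitiveRoot ω m := Complex.isPrimitiveRoot_exp m (by omega)
  have hω2 : ω * (1 / 2) ∈ disc := by
    rw [mem_disc, norm_mul, hprim.norm'_eq_one (by omega)]
    norm_num
  have heq : k (blaschkeFactor (-h 0) (ω * (1 / 2))) = k (blaschkeFactor (-h 0) (1 / 2)) := by
    rw [hkpow _ (blaschkeFactor_mem_disc hna hω2), hkpow _ (blaschkeFactor_mem_disc hna h02),
      blaschkeFactor_neg_comp ha0 hω2, blaschkeFactor_neg_comp ha0 h02, mul_pow, hprim.pow_eq_one,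
      one_mul]
  have h1 := congrArg h heq
  rw [hhk _ (blaschkeFactor_mem_disc hna hω2), hhk _ (blaschkeFactor_mem_disc hna h02)] at h1
  have h2 := congrArg (blaschkeFactor (h 0)) h1
  rw [blaschkeFactor_neg_comp ha0 hω2, blaschkeFactor_neg_comp ha0 h02] at h2
  have hω1 : ω = 1 := by
    have h3 : (1 / 2 : ℂ) ≠ 0 := by norm_num
    exact mul_right_cancel₀ h3 (h2.trans (one_mul _).symm)
  have hm1 : m = 1 := by
    rw [hω1] at hprim
    exact hprim.unique IsPrimitiveRoot.one
  subst hm1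
  exact ⟨c, h 0, ha0, fun z hz => by rw [hkpow z hz, pow_one]⟩

/-- The homogenization of `symPoly w`. -/
noncomputable def symPolyHom {n : ℕ} (A B : ℂ[X]) (w : Fin n → ℂ) : ℂ[X] :=
  A ^ n + ∑ k : Fin n, C ((-1) ^ ((k : ℕ) + 1) * w k) *
    (A ^ (n - 1 - (k : ℕ)) * B ^ ((k : ℕ) + 1))

lemma differentiable_coeff_symPolyHom {n : ℕ} (A B : ℂ[X]) (l : ℕ) :
    Differentiable ℂ (fun w : Fin n → ℂ => (symPolyHom A B w).coeff l) := by
  simp only [symPolyHom, coeff_add, finsetSum_coeff, coeff_C_mul]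
  fun_prop

/-- A Möbius transformation of the disc induces a holomorphic map of the symmetrized polydisc. -/
lemma exists_symMap_blaschkeFactor (n : ℕ) (c : ℂ) {a : ℂ} (ha : a ∈ disc) :
    ∃ g : (Fin n → ℂ) → (Fin n → ℂ), DifferentiableOn ℂ g (symPolydisc n) ∧
      ∀ z ∈ polydisc n, g (symMap n z) = symMap n (fun j => c * blaschkeFactor a (z j)) := by
  -- Clearing denominators in X - c(z - a)/(1 - āz) gives (X + ca) - z(āX + c). The product over the
  -- roots, and the product D of the denominators, are polynomial in the elementary symmetric
  -- functions.
  let N : (Fin n → ℂ) → ℂ[X] :=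
    symPolyHom (X + C (c * a)) (C (starRingEnd ℂ a) * X + C c)
  let D : (Fin n → ℂ) → ℂ := fun w => (symPolyHom 1 (C (starRingEnd ℂ a)) w).coeff 0
  have hD : ∀ z, D (symMap n z) = ∏ j, (1 - starRingEnd ℂ a * z j) := fun z => by
    change (symPolyHom 1 (C (starRingEnd ℂ a)) (symMap n z)).coeff 0 = _
    rw [symPolyHom, ← prod_sub_C_mul, coeff_zero_eq_eval_zero, eval_prod]
    simp [mul_comm]
  have hD0 : ∀ z ∈ polydisc n, D (symMap n z) ≠ 0 := fun z hz => by
    rw [hD, Finset.prod_ne_zero_iff]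
    exact fun j _ => one_sub_conj_mul_ne_zero ha (hz j)
  have hN : ∀ z ∈ polydisc n, N (symMap n z) =
      C (D (symMap n z)) * symPoly (symMap n (fun j => c * blaschkeFactor a (z j))) := by
    intro z hz
    change symPolyHom _ _ (symMap n z) = _
    rw [symPolyHom, ← prod_sub_C_mul, symPoly_symMap, hD, map_prod, ← Finset.prod_mul_distrib]
    refine Finset.prod_congr rfl fun j _ => ?_
    have h1 := one_sub_conj_mul_ne_zero ha (hz j)
    have h2 : (1 - starRingEnd ℂ a * z j) * (c * blaschkeFactor a (z j)) = c * (z j - a) := by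
      rw [blaschkeFactor]
      field_simp
    rw [mul_sub, ← C_mul, h2]
    simp only [C_mul, C_sub, C_1]
    ring
  refine ⟨fun w k => (-1) ^ ((k : ℕ) + 1) * (N w).coeff (n - 1 - k) / D w, ?_, fun z hz => ?_⟩
  · refine differentiableOn_pi.2 fun k => ?_
    have h1 : Differentiable ℂ D := differentiable_coeff_symPolyHom _ _ _
    have h2 : Differentiable ℂ (fun w => (-1) ^ ((k : ℕ) + 1) * (N w).coeff (n - 1 - k)) :=
      (differentiable_coeff_symPolyHom _ _ _).const_mul _
    simp only [div_eq_mul_inv]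
    refine h2.differentiableOn.fun_mul (h1.differentiableOn.fun_inv ?_)
    · rintro _ ⟨z, hz, rfl⟩
      exact hD0 z hz
  · ext k
    change (-1) ^ ((k : ℕ) + 1) * (N (symMap n z)).coeff (n - 1 - k) / D (symMap n z) = _
    rw [hN z hz, coeff_C_mul, symPoly_coeff_sub, div_eq_iff (hD0 z hz)]
    have : ((-1 : ℂ) ^ ((k : ℕ) + 1)) * (-1) ^ ((k : ℕ) + 1) = 1 := by
      rw [← mul_pow]
      simp
    linear_combination (D (symMap n z) * symMap n (fun j => c * blaschkeFactor a (z j)) k) * this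

/-- The inverse of `h` is Möbius, so it induces an explicit rational map of the symmetrized
polydisc; this supplies the holomorphic inverse of `f`. -/
lemma isHolAut_of_symMap {n : ℕ} {f : (Fin n → ℂ) → (Fin n → ℂ)}
    (hmaps : Set.MapsTo f (symPolydisc n) (symPolydisc n)) (hd : DifferentiableOn ℂ f (symPolydisc n))
    {h : ℂ → ℂ} (hh : IsHolAut disc h)
    (hf : ∀ z ∈ polydisc n, f (symMap n z) = symMap n (fun j => h (z j))) :
    IsHolAut (symPolydisc n) f := by
  obtain ⟨hhm, hhd, k, hkm, hkd, hkh, hhk⟩ := hh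
  obtain ⟨c, a, ha, hk⟩ := IsHolAut.exists_eq_blaschkeFactor ⟨hkm, hkd, h, hhm, hhd, hhk, hkh⟩
  obtain ⟨g, hgd, hg⟩ := exists_symMap_blaschkeFactor n c ha
  have hg' : ∀ z ∈ polydisc n, g (symMap n z) = symMap n (fun j => k (z j)) := fun z hz => by
    rw [hg z hz]
    congr 1
    ext j
    rw [hk _ (hz j)]
  refine ⟨hmaps, hd, g, ?_, hgd, ?_, ?_⟩
  · rintro _ ⟨z, hz, rfl⟩
    rw [hg' z hz]
    exact ⟨_, fun j => hkm (hz j), rfl⟩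
  · rintro _ ⟨z, hz, rfl⟩
    rw [hf z hz, hg' _ (fun j => hhm (hz j))]
    simp only [hkh _ (hz _)]
  · rintro _ ⟨z, hz, rfl⟩
    rw [hg' z hz, hf _ (fun j => hkm (hz j))]
    simp only [hhk _ (hz _)]

end SymPolydisc

theorem theorem1 (n : ℕ) (hn : 1 ≤ n) (f : (Fin n → ℂ) → (Fin n → ℂ))
    (hmaps : Set.MapsTo f (SymPolydisc.symPolydisc n) (SymPolydisc.symPolydisc n))
    (hf : DifferentiableOn ℂ f (SymPolydisc.symPolydisc n)) :
    (IsProperMap (hmaps.restrict f (SymPolydisc.symPolydisc n) (SymPolydisc.symPolydisc n)) ↔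
      ∃ B : ℂ → ℂ, SymPolydisc.IsFiniteBlaschke B ∧
        ∀ z ∈ SymPolydisc.polydisc n,
          f (SymPolydisc.symMap n z) = SymPolydisc.symMap n (fun j => B (z j))) ∧
    (SymPolydisc.IsHolAut (SymPolydisc.symPolydisc n) f ↔
      ∃ h : ℂ → ℂ, SymPolydisc.IsHolAut SymPolydisc.disc h ∧
        ∀ z ∈ SymPolydisc.polydisc n,
          f (SymPolydisc.symMap n z) = SymPolydisc.symMap n (fun j => h (z j))) :=
  ⟨⟨SymPolydisc.exists_blaschke_of_isProperMap hn hf,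
    fun ⟨_, hB, hBf⟩ => SymPolydisc.isProperMap_of_blaschke hmaps hf hB hBf⟩,
   ⟨SymPolydisc.exists_holAut_of_isHolAut hn,
    fun ⟨_, hh, hhf⟩ => SymPolydisc.isHolAut_of_symMap hmaps hf hh hhf⟩⟩
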